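/- Let $r>1$ be irrational and $P_r=\{\lfloor nr\rfloor : n\in\mathbb Z,\ n\neq 0\}$. Let $L_P=\{+,-,0,1,P\}$, where $+,-,0,1$ are the symbols of abelian groups with a distinguished element ($-$ is unary) and $P$ is a unary predicate. Let $L_\pm$ be $L_P$ together with unary predicates $D_{m,+},D_{m,-}$ for all $m\ge 1$. Read $P$ in $\mathbb Z$ as $P_r$, read $D_{m,+}$ as $\{my : y\in P_r\}$ and $D_{m,-}$ as $\{my : y\in\mathbb Z,\ y\notin P_r\}$. For $n\ge 0$, $k\in\mathbb Z^n$ and $I\subseteq\{1,\dots,n\}$ let $\varphi_{k,I}(x_1,\dots,x_n)$ be the $L_P$-formula $$\exists y\Big(\bigwedge_{i\in I} x_i+k_iy\in P\ \wedge\ \bigwedge_{i\notin I}x_i+k_iy\notin P\Big).$$ (1) One can choose, for all $n$, $k$ and $I$, a quantifier-free $L_\pm$-formula $\psi_{k,I}(x_1,\dots,x_n)$, considered as an $L_P$-formula by writing out every $D_{m,+}(t)$ as $\exists y\,(t=my\wedge y\in P)$ and every $D_{m,-}(t)$ as $\exists y\,(t=my\wedge y\notin P)$, such that $(\mathbb Z,+,-,0,1,P_r)\models\forall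 x_1\cdots\forall x_n(\varphi_{k,I}\leftrightarrow\psi_{k,I})$ for all $n,k,I$, and such that the following holds. Let $T_r$ be the $L_P$-theory consisting of the complete theory of $(\mathbb Z,+,-,0,1)$ and of all the sentences $\forall x_1\cdots\forall x_n(\varphi_{k,I}\leftrightarrow\psi_{k,I})$, and let $T_\pm$ be its definitional expansion to $L_\pm$ by the axioms $\forall x\,(D_{m,+}(x)\leftrightarrow\exists y\,(x=my\wedge y\in P))$ and $\forall x\,(D_{m,-}(x)\leftrightarrow\exists y\,(x=my\wedge y\notin P))$ for $m\ge 1$. Then $T_\pm$ has quantifier elimination: every $L_\pm$-formula is equivalent modulo $T_\pm$ to a quantifier-free $L_\pm$-formula in the same free variables. (2) The structure $\big(\mathbb Z,+,-,0,1,(D_{m,+})_{m\ge1},(D_{m,-})_{m\ge1}\big)$ has quantifier elimination. -/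

import Mathlib

open FirstOrder FirstOrder.Language

namespace BeattyQE

/-! ### The set `P_r` -/

/-- `P_r = {⌊n r⌋ : n ∈ ℤ, n ≠ 0}`. -/
def beattySet (r : ℝ) : Set ℤ :=
  {x | ∃ n : ℤ, n ≠ 0 ∧ x = ⌊(n : ℝ) * r⌋}

/-! ### The languages -/

/-- Function symbols `0, 1, -, +`. -/
inductive GroupFunc : ℕ → Type
  | zero : GroupFunc 0
  | one : GroupFunc 0
  | neg : GroupFunc 1
  | add : GroupFunc 2

/-- The unary predicate symbol `P`. -/
inductive BeattyRel : ℕ → Type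
  | P : BeattyRel 1

/-- The unary predicate symbols `D_{m,+}` and `D_{m,-}`, for `m ≥ 1`. -/
inductive DivRel : ℕ → Type
  | pos (m : ℕ+) : DivRel 1
  | neg (m : ℕ+) : DivRel 1

/-- The language `{+, -, 0, 1}` of abelian groups with a distinguished element. -/
abbrev groupLang : FirstOrder.Language.{0, 0} := ⟨GroupFunc, fun _ => Empty⟩

/-- The language `{P}`. -/
abbrev beattyLang : FirstOrder.Language.{0, 0} := ⟨fun _ => Empty, BeattyRel⟩

/-- The language `{D_{m,+}, D_{m,-} : m ≥ 1}`. -/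
abbrev divLang : FirstOrder.Language.{0, 0} := ⟨fun _ => Empty, DivRel⟩

/-- `L_P = {+, -, 0, 1, P}`. -/
abbrev langP : FirstOrder.Language.{0, 0} := groupLang.sum beattyLang

/-- `L_± = {+, -, 0, 1, P} ∪ {D_{m,+}, D_{m,-} : m ≥ 1}`. -/
abbrev langPM : FirstOrder.Language.{0, 0} := langP.sum divLang

/-- `{+, -, 0, 1} ∪ {D_{m,+}, D_{m,-} : m ≥ 1}`, without `P`. -/
abbrev langD : FirstOrder.Language.{0, 0} := groupLang.sum divLang

/-- The symbol `P` in `L_P`. -/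
abbrev symP : langP.Relations 1 := Sum.inr BeattyRel.P

/-- The symbol `D_{m,+}` in `L_±`. -/
abbrev symPos (m : ℕ+) : langPM.Relations 1 := Sum.inr (DivRel.pos m)

/-- The symbol `D_{m,-}` in `L_±`. -/
abbrev symNeg (m : ℕ+) : langPM.Relations 1 := Sum.inr (DivRel.neg m)

/-! ### The standard structures -/

instance : groupLang.Structure ℤ where
  funMap
    | .zero, _ => 0
    | .one, _ => 1
    | .neg, v => -(v 0)
    | .add, v => v 0 + v 1
  RelMap R _ := Empty.elim R

/-- The integers, as the universe of the structures in which `P` is read as `P_r`. -/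
def BeattyInt (_r : ℝ) : Type := ℤ

/-- An element of the universe, as an integer. -/
def BeattyInt.toInt {r : ℝ} (x : BeattyInt r) : ℤ := x

instance (r : ℝ) : groupLang.Structure (BeattyInt r) :=
  inferInstanceAs (groupLang.Structure ℤ)

instance (r : ℝ) : beattyLang.Structure (BeattyInt r) where
  funMap f _ := Empty.elim f
  RelMap
    | .P, v => (v 0).toInt ∈ beattySet r

instance (r : ℝ) : divLang.Structure (BeattyInt r) where
  funMap f _ := Empty.elim f
  RelMap
    | .pos m, v => ∃ y : ℤ, y ∈ beattySet r ∧ (v 0).toInt = ((m : ℕ) : ℤ) * y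
    | .neg m, v => ∃ y : ℤ, y ∉ beattySet r ∧ (v 0).toInt = ((m : ℕ) : ℤ) * y

/-! ### `L_P`-terms and formulas -/

/-- The term `-t`. -/
def negTerm {α : Type} (t : langP.Term α) : langP.Term α :=
  Functions.apply₁ (L := langP) (Sum.inl GroupFunc.neg) t

/-- The term `s + t`. -/
def addTerm {α : Type} (s t : langP.Term α) : langP.Term α :=
  Functions.apply₂ (L := langP) (Sum.inl GroupFunc.add) s t

/-- The term `k t = t + ⋯ + t`, for a natural number `k`. -/
def nsmulTerm {α : Type} : ℕ → langP.Term α → langP.Term α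
  | 0, _ => Constants.term (L := langP) (Sum.inl GroupFunc.zero)
  | k + 1, t => addTerm (nsmulTerm k t) t

/-- The term `k t`, for an integer `k`. -/
def zsmulTerm {α : Type} : ℤ → langP.Term α → langP.Term α
  | Int.ofNat k, t => nsmulTerm k t
  | Int.negSucc k, t => negTerm (nsmulTerm (k + 1) t)

/-- The formula `t ∈ P`. -/
def memP {α : Type} {n : ℕ} (t : langP.Term (α ⊕ Fin n)) : langP.BoundedFormula α n :=
  symP.boundedFormula₁ t

/-- The formula `φ_{k,I}(x_1, …, x_n)`:
`∃ y (⋀_{i ∈ I} x_i + k_i y ∈ P ∧ ⋀_{i ∉ I} x_i + k_i y ∉ P)`. -/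
noncomputable def patternFormula {n : ℕ} (k : Fin n → ℤ) (I : Finset (Fin n)) :
    langP.BoundedFormula Empty n :=
  (BoundedFormula.iInf fun i : Fin n =>
    if i ∈ I then memP (addTerm (&i.castSucc) (zsmulTerm (k i) (&(Fin.last n))))
    else ∼(memP (addTerm (&i.castSucc) (zsmulTerm (k i) (&(Fin.last n)))))).ex

/-- A term in the variables `x_1, …, x_n`, seen in the variables `x_1, …, x_n, y`. -/
def liftTerm {n : ℕ} (t : langP.Term (Empty ⊕ Fin n)) : langP.Term (Empty ⊕ Fin (n + 1)) :=
  t.relabel (Sum.map id Fin.castSucc)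

/-- The `L_P`-formula `∃ y (t = m y ∧ y ∈ P)`, which defines `D_{m,+}(t)`. -/
def divPos {n : ℕ} (m : ℕ+) (t : langP.Term (Empty ⊕ Fin n)) : langP.BoundedFormula Empty n :=
  ((liftTerm t =' nsmulTerm m (&(Fin.last n))) ⊓ memP (&(Fin.last n))).ex

/-- The `L_P`-formula `∃ y (t = m y ∧ y ∉ P)`, which defines `D_{m,-}(t)`. -/
def divNeg {n : ℕ} (m : ℕ+) (t : langP.Term (Empty ⊕ Fin n)) : langP.BoundedFormula Empty n :=
  ((liftTerm t =' nsmulTerm m (&(Fin.last n))) ⊓ ∼(memP (&(Fin.last n)))).ex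

/-- The `L_P`-formulas that are quantifier-free `L_±`-formulas with every `D_{m,+}(t)` and
`D_{m,-}(t)` written out by its definition, i.e. the Boolean combinations of atomic `L_P`-formulas
and of the formulas `D_{m,+}(t)`, `D_{m,-}(t)`. -/
inductive IsQFWithDiv {n : ℕ} : langP.BoundedFormula Empty n → Prop
  | falsum : IsQFWithDiv BoundedFormula.falsum
  | of_isAtomic {φ : langP.BoundedFormula Empty n} (h : φ.IsAtomic) : IsQFWithDiv φ
  | divPos (m : ℕ+) (t : langP.Term (Empty ⊕ Fin n)) : IsQFWithDiv (divPos m t)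
  | divNeg (m : ℕ+) (t : langP.Term (Empty ⊕ Fin n)) : IsQFWithDiv (divNeg m t)
  | imp {φ₁ φ₂ : langP.BoundedFormula Empty n} (h₁ : IsQFWithDiv φ₁) (h₂ : IsQFWithDiv φ₂) :
      IsQFWithDiv (φ₁.imp φ₂)

/-- The sentence `∀ x_1 ⋯ ∀ x_n (φ_{k,I}(x_1, …, x_n) ↔ ψ(x_1, …, x_n))`. -/
noncomputable def patternSentence {n : ℕ} (k : Fin n → ℤ) (I : Finset (Fin n))
    (ψ : langP.BoundedFormula Empty n) : langP.Sentence :=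
  ((patternFormula k I).iff ψ).alls

/-- A choice of a formula `ψ_{k,I}(x_1, …, x_n)` for every `n`, `k ∈ ℤⁿ` and
`I ⊆ {1, …, n}`. -/
abbrev PatternFamily : Type :=
  ∀ n : ℕ, (Fin n → ℤ) → Finset (Fin n) → langP.BoundedFormula Empty n

/-! ### The theories -/

/-- `T_r`: the theory of `(ℤ, +, -, 0, 1)` together with all the sentences
`∀ x (φ_{k,I}(x) ↔ ψ_{k,I}(x))`. The number `r` enters through the choice of `ψ`. -/
noncomputable def theoryP (ψ : PatternFamily) : langP.Theory :=
  (LHom.sumInl : groupLang →ᴸ langP).onTheory (groupLang.completeTheory ℤ) ∪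
    {σ | ∃ (n : ℕ) (k : Fin n → ℤ) (I : Finset (Fin n)), σ = patternSentence k I (ψ n k I)}

/-- The sentence `∀ x (D_{m,+}(x) ↔ ∃ y (x = m y ∧ y ∈ P))`. -/
def divPosAxiom (m : ℕ+) : langPM.Sentence :=
  (((symPos m).boundedFormula₁ (α := Empty) (n := 1) (&0)).iff
    ((LHom.sumInl : langP →ᴸ langPM).onBoundedFormula (divPos m (&0)))).alls

/-- The sentence `∀ x (D_{m,-}(x) ↔ ∃ y (x = m y ∧ y ∉ P))`. -/
def divNegAxiom (m : ℕ+) : langPM.Sentence :=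
  (((symNeg m).boundedFormula₁ (α := Empty) (n := 1) (&0)).iff
    ((LHom.sumInl : langP →ᴸ langPM).onBoundedFormula (divNeg m (&0)))).alls

/-- `T_±`: the definitional expansion of `T_r` by the predicates `D_{m,+}` and `D_{m,-}`. -/
noncomputable def theoryPM (ψ : PatternFamily) : langPM.Theory :=
  (LHom.sumInl : langP →ᴸ langPM).onTheory (theoryP ψ) ∪
    (Set.range divPosAxiom ∪ Set.range divNegAxiom)

/-! ### Quantifier elimination -/

/-- The theory `T` has quantifier elimination: every formula is equivalent modulo `T` to a
quantifier-free formula in the same free variables. -/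
def TheoryHasQE {L : FirstOrder.Language.{0, 0}} (T : L.Theory) : Prop :=
  ∀ (n : ℕ) (φ : L.Formula (Fin n)), ∃ θ : L.Formula (Fin n),
    BoundedFormula.IsQF θ ∧ Theory.Iff T φ θ

/-- The structure `M` has quantifier elimination: every formula is equivalent in `M` to a
quantifier-free formula in the same free variables. -/
def StructureHasQE (L : FirstOrder.Language.{0, 0}) (M : Type) [L.Structure M] : Prop :=
  ∀ (n : ℕ) (φ : L.Formula (Fin n)), ∃ θ : L.Formula (Fin n),
    BoundedFormula.IsQF θ ∧ ∀ v : Fin n → M, φ.Realize v ↔ θ.Realize v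

end BeattyQE

/-!
Put `α = r⁻¹`. An integer `z` lies in `P_r` if and only if `α z` lies in the open arc `(-α, 0)` of
the circle `ℝ / ℤ`, and the end points `-α` and `0` of this arc are attained only for `z = -1` and
`z = 0` (`mem_beattySet_iff_arc`, `notMem_beattySet_iff_arc`).

*Patterns in the integers.* The formula `∃ y ⋀ (x_i + k_i y ∈ P ↔ i ∈ I)` has a solution `y` of one
of two kinds. Either `y` solves one of the finitely many equations `x_i + k_i y ∈ {0, -1}` with
`k_i ≠ 0`; then `y` is a quotient of a term by `k_i`, and the predicates `D_{m,±}` express the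
pattern for it. Or all conditions on `α y` are open; by density of the numbers `α y` modulo `1` a
real solution is then enough, and Fourier–Motzkin elimination turns its existence into finitely
many inequalities `0 < ∑ c_i {α x_i} + p + q α` with integral `c_i, p, q`. Such inequalities are
quantifier-free: a sum of fractional parts is the fractional part of the sum up to carries, a carry
compares two fractional parts, and two fractional parts are compared by finitely many arcs with
end points in `ℤ α` if they are far apart, and by `P` applied to the difference if they are close
(`IsQFDefinable.fract_lt_fract`, `IsTame`, `IsQFDefinable.exists_pattern`).

*Equations.* For `R = ⌊r⌋`, the only integer `x` such that none of `x - R, …, x + R - 1` lies in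
`P_r` is `x = 0` (`eq_zero_iff_forall_notMem`). This is a universal statement, so it can be added
as a conjunct to all the quantifier-free formulas of the family, and it thereby holds in all models
of the theory. Modulo the theory no equations are then needed, and in particular no inequations
`y ≠ t` have to be respected in the elimination of `∃ y`.

*Elimination.* A quantifier-free formula in `x` and `y` is now a Boolean combination of conditions
`D_{N,±}(τ_i(x) + c_i y)` with a common `N` (`exists_divSign_common`). After the substitution
`y = N q + j` with `0 ≤ j < N`, such a condition says that `N` divides `τ_i + c_i j`, and that the
quotient `z_i` satisfies `z_i + c_i q ∈ P`, or `∉ P`. The statement `∃ q` about the latter is a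
pattern in `z`, hence quantifier-free in `z` by the axioms, and it becomes quantifier-free in `x`
on multiplying all terms by `N` (`exists_isQF_nsmul`). Only torsion-freeness and division with
remainder are used from the theory of `(ℤ, +, -, 0, 1)`.

Quantifier elimination for the integers without the symbol `P` follows, since `P` is `D_{1,+}`.
-/

namespace BeattyQE

/-! ### Terms and formulas over an abelian group -/

section GroupStructure

/-- The symbols `0, 1, -, +` of `L_P` are read in `M` as the operations of an abelian group with
a distinguished element. -/
class IsGroupStructure (M : Type) [langP.Structure M] [AddCommGroup M] [One M] : Prop where
  funMap_zero : ∀ v : Fin 0 → M,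
    Structure.funMap (L := langP) (Sum.inl GroupFunc.zero : langP.Functions 0) v = 0
  funMap_one : ∀ v : Fin 0 → M,
    Structure.funMap (L := langP) (Sum.inl GroupFunc.one : langP.Functions 0) v = 1
  funMap_neg : ∀ v : Fin 1 → M,
    Structure.funMap (L := langP) (Sum.inl GroupFunc.neg : langP.Functions 1) v = -(v 0)
  funMap_add : ∀ v : Fin 2 → M,
    Structure.funMap (L := langP) (Sum.inl GroupFunc.add : langP.Functions 2) v = v 0 + v 1

/-- The interpretation of the predicate `P`. -/
def InP {M : Type} [langP.Structure M] (a : M) : Prop :=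
  Structure.RelMap (symP) ![a]

variable {M : Type} [langP.Structure M] {α : Type} {n : ℕ}

theorem realize_boundedFormula_one {L : FirstOrder.Language.{0, 0}} {M : Type} [L.Structure M]
    (R : L.Relations 1) (ts : Fin 1 → L.Term (α ⊕ Fin n)) (v : α → M) (x : Fin n → M) :
    (R.boundedFormula ts).Realize v x ↔
      Structure.RelMap R ![(ts 0).realize (Sum.elim v x)] := by
  rw [BoundedFormula.realize_rel]
  refine iff_of_eq (congrArg _ ?_)
  funext i
  fin_cases i
  rfl

theorem realize_memP (t : langP.Term (α ⊕ Fin n)) (v : α → M) (x : Fin n → M) :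
    (memP t).Realize v x ↔ InP (t.realize (Sum.elim v x)) :=
  BoundedFormula.realize_rel₁

theorem realize_liftTerm (t : langP.Term (Empty ⊕ Fin n)) (v : Empty → M) (x : Fin n → M)
    (y : M) : (liftTerm t).realize (Sum.elim v (Fin.snoc x y : Fin (n + 1) → M)) =
      t.realize (Sum.elim v x) := by
  rw [liftTerm, Term.realize_relabel]
  congr 1
  funext i
  rcases i with i | i
  · rfl
  · simp

/-- The term `0`. -/
def zeroTerm {α : Type} : langP.Term α :=
  Constants.term (L := langP) (Sum.inl GroupFunc.zero)

/-- The term `1`. -/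
def oneTerm {α : Type} : langP.Term α :=
  Constants.term (L := langP) (Sum.inl GroupFunc.one)

variable [AddCommGroup M] [One M] [IsGroupStructure M]

theorem realize_zeroTerm (v : α → M) :
    (zeroTerm : langP.Term α).realize v = 0 :=
  IsGroupStructure.funMap_zero _

theorem realize_oneTerm (v : α → M) :
    (oneTerm : langP.Term α).realize v = 1 :=
  IsGroupStructure.funMap_one _

theorem realize_negTerm (t : langP.Term α) (v : α → M) :
    (negTerm t).realize v = -(t.realize v) :=
  IsGroupStructure.funMap_neg _

theorem realize_addTerm (s t : langP.Term α) (v : α → M) :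
    (addTerm s t).realize v = s.realize v + t.realize v :=
  IsGroupStructure.funMap_add _

theorem realize_nsmulTerm (k : ℕ) (t : langP.Term α) (v : α → M) :
    (nsmulTerm k t).realize v = k • t.realize v := by
  induction k with
  | zero => exact (realize_zeroTerm v).trans (zero_smul ℕ _).symm
  | succ k ih => rw [nsmulTerm, realize_addTerm, ih, succ_nsmul]

theorem realize_zsmulTerm (k : ℤ) (t : langP.Term α) (v : α → M) :
    (zsmulTerm k t).realize v = k • t.realize v := by
  cases k with
  | ofNat k => rw [zsmulTerm, realize_nsmulTerm]; simp
  | negSucc k => rw [zsmulTerm, realize_negTerm, realize_nsmulTerm, negSucc_zsmul]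

theorem realize_divPos (m : ℕ+) (t : langP.Term (Empty ⊕ Fin n)) (v : Empty → M)
    (x : Fin n → M) : (divPos m t).Realize v x ↔
      ∃ y : M, t.realize (Sum.elim v x) = (m : ℕ) • y ∧ InP y := by
  simp only [divPos, BoundedFormula.realize_ex, BoundedFormula.realize_inf,
    BoundedFormula.realize_bdEqual, realize_liftTerm, realize_nsmulTerm, realize_memP]
  simp

theorem realize_divNeg (m : ℕ+) (t : langP.Term (Empty ⊕ Fin n)) (v : Empty → M)
    (x : Fin n → M) : (divNeg m t).Realize v x ↔
      ∃ y : M, t.realize (Sum.elim v x) = (m : ℕ) • y ∧ ¬ InP y := by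
  simp only [divNeg, BoundedFormula.realize_ex, BoundedFormula.realize_inf,
    BoundedFormula.realize_bdEqual, realize_liftTerm, realize_nsmulTerm, realize_memP,
    BoundedFormula.realize_not]
  simp

theorem realize_patternFormula (k : Fin n → ℤ) (I : Finset (Fin n)) (v : Empty → M)
    (x : Fin n → M) : (patternFormula k I).Realize v x ↔
      ∃ y : M, ∀ i, InP (x i + k i • y) ↔ i ∈ I := by
  simp only [patternFormula, BoundedFormula.realize_ex, BoundedFormula.realize_iInf]
  refine exists_congr fun y => forall_congr' fun i => ?_
  split_ifs with h <;>
  simp [h, realize_memP, realize_addTerm, realize_zsmulTerm]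

theorem realize_patternSentence (k : Fin n → ℤ) (I : Finset (Fin n))
    (ψ : langP.BoundedFormula Empty n) : M ⊨ patternSentence k I ψ ↔
      ∀ x : Fin n → M, (∃ y : M, ∀ i, InP (x i + k i • y) ↔ i ∈ I) ↔ ψ.Realize default x := by
  rw [patternSentence, Sentence.Realize, BoundedFormula.realize_alls]
  simp only [BoundedFormula.realize_iff, realize_patternFormula]

end GroupStructure

/-! ### The standard model -/

section Standard

variable {r : ℝ}

instance : AddCommGroup (BeattyInt r) := inferInstanceAs (AddCommGroup ℤ)

instance : One (BeattyInt r) := inferInstanceAs (One ℤ)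

instance : IsGroupStructure (BeattyInt r) where
  funMap_zero _ := rfl
  funMap_one _ := rfl
  funMap_neg _ := rfl
  funMap_add _ := rfl

theorem inP_beattyInt (z : BeattyInt r) : InP z ↔ z.toInt ∈ beattySet r := Iff.rfl

end Standard

/-! ### Arithmetic of the Beatty set -/

section Arith

variable {r : ℝ}

theorem irrational_inv_mul (hr : Irrational r) {z : ℤ} (hz : z ≠ 0) : Irrational (r⁻¹ * z) :=
  (irrational_inv_iff.2 hr).mul_intCast hz

theorem eq_zero_of_inv_mul_eq_int (hr : Irrational r) {z j : ℤ} (h : r⁻¹ * z = j) : z = 0 := by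
  by_contra hz
  exact (irrational_inv_mul hr hz).ne_int j h

/-- Modulo `1`, the set `r⁻¹ P_r` lies in the open arc `(-r⁻¹, 0)`, and `P_r` is the full preimage
of this arc. -/
theorem mem_beattySet_iff_arc (hr : Irrational r) (hr1 : 1 < r) (z : ℤ) :
    z ∈ beattySet r ↔ ∃ j : ℤ, -r⁻¹ + j < r⁻¹ * z ∧ r⁻¹ * z < j := by
  have h0 : 0 < r := by linarith
  have key : ∀ j : ℤ, (-r⁻¹ + j < r⁻¹ * z ∧ r⁻¹ * z < j) ↔
      ((z : ℝ) < j * r ∧ (j : ℝ) * r < z + 1) := by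
    intro j
    have e : (j : ℝ) = r⁻¹ * (j * r) := by field_simp
    rw [and_comm]
    refine and_congr ?_ ?_
    · rw [e, mul_lt_mul_iff_right₀ (inv_pos.2 h0), ← e]
    · have : -r⁻¹ + j < r⁻¹ * z ↔ r⁻¹ * (j * r) < r⁻¹ * (z + 1) := by
        rw [← e]; constructor <;> intro h <;> linarith
      rw [this, mul_lt_mul_iff_right₀ (inv_pos.2 h0)]
  simp only [key]
  constructor
  · rintro ⟨n, hn, rfl⟩
    refine ⟨n, lt_of_le_of_ne (Int.floor_le _) ?_, Int.lt_floor_add_one _⟩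
    exact fun h => (hr.intCast_mul hn).ne_int _ h.symm
  · rintro ⟨j, h1, h2⟩
    refine ⟨j, ?_, ?_⟩
    · rintro rfl
      simp only [Int.cast_zero, zero_mul] at h1 h2
      have h3 : z < 0 := by exact_mod_cast h1
      have h4 : (0 : ℤ) < z + 1 := by exact_mod_cast h2
      omega
    · exact (Int.floor_eq_iff.2 ⟨h1.le, h2⟩).symm

theorem mem_beattySet_iff_fract (hr : Irrational r) (hr1 : 1 < r) (z : ℤ) :
    z ∈ beattySet r ↔ 1 - r⁻¹ < Int.fract (r⁻¹ * z) := by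
  have h1 : r⁻¹ < 1 := inv_lt_one_of_one_lt₀ hr1
  rw [mem_beattySet_iff_arc hr hr1, Int.fract]
  constructor
  · rintro ⟨j, h2, h3⟩
    have : ⌊r⁻¹ * (z : ℝ)⌋ ≤ j - 1 := by
      have := Int.floor_lt.2 h3
      omega
    have : ((⌊r⁻¹ * (z : ℝ)⌋ : ℤ) : ℝ) ≤ j - 1 := by exact_mod_cast this
    linarith
  · intro h
    refine ⟨⌊r⁻¹ * (z : ℝ)⌋ + 1, ?_, ?_⟩
    · push_cast; linarith
    · push_cast; exact Int.lt_floor_add_one _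

/-- The complement of `P_r` is the preimage of the closed arc `[0, 1 - r⁻¹]`, whose end points
are attained only at `0` and at `-1`. -/
theorem notMem_beattySet_iff_arc (hr : Irrational r) (hr1 : 1 < r) (z : ℤ) (h0 : z ≠ 0)
    (h1 : z ≠ -1) :
    z ∉ beattySet r ↔ ∃ j : ℤ, 0 + j < r⁻¹ * z ∧ r⁻¹ * z < (1 - r⁻¹) + j := by
  rw [mem_beattySet_iff_fract hr hr1, not_lt]
  constructor
  · intro h
    refine ⟨⌊r⁻¹ * (z : ℝ)⌋, ?_, ?_⟩
    · refine lt_of_le_of_ne (by simpa using Int.floor_le _) ?_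
      intro e
      rw [zero_add] at e
      exact h0 (eq_zero_of_inv_mul_eq_int hr e.symm)
    · rw [Int.fract] at h
      refine lt_of_le_of_ne (by linarith) ?_
      intro e
      refine h1 (eq_neg_of_add_eq_zero_left
        (eq_zero_of_inv_mul_eq_int (j := ⌊r⁻¹ * (z : ℝ)⌋ + 1) hr ?_))
      push_cast
      linarith
  · rintro ⟨j, h2, h3⟩
    have hi : 0 < r⁻¹ := by positivity
    have : ⌊r⁻¹ * (z : ℝ)⌋ = j := Int.floor_eq_iff.2 ⟨by linarith, by linarith⟩
    rw [Int.fract, this]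
    linarith

theorem fract_pos_iff (hr : Irrational r) (z : ℤ) : 0 < Int.fract (r⁻¹ * z) ↔ z ≠ 0 := by
  rw [Int.fract_pos]
  constructor
  · rintro h rfl
    simp at h
  · intro h e
    exact h (eq_zero_of_inv_mul_eq_int hr e)

/-- The numbers `r⁻¹ y + m` with integral `y, m` are dense. -/
theorem exists_inv_mul_add_mem (hr : Irrational r) {U : Set ℝ} (hU : IsOpen U)
    (hne : U.Nonempty) : ∃ y m : ℤ, r⁻¹ * y + m ∈ U := by
  have hd : Dense (AddSubgroup.closure {r⁻¹, (1 : ℝ)} : Set ℝ) := by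
    rw [dense_addSubgroupClosure_pair_iff, div_one]
    exact irrational_inv_iff.2 hr
  obtain ⟨x, hx, hxU⟩ := hd.exists_mem_open hU hne
  obtain ⟨a, b, rfl⟩ := AddSubgroup.mem_closure_pair.1 hx
  refine ⟨a, b, ?_⟩
  simpa [mul_comm] using hxU

theorem exists_fract_mem_Ioo (hr : Irrational r) {a b : ℝ} (ha : 0 ≤ a) (hab : a < b)
    (hb : b ≤ 1) : ∃ m : ℤ, a < Int.fract (r⁻¹ * m) ∧ Int.fract (r⁻¹ * m) < b := by
  obtain ⟨y, m, h1, h2⟩ := exists_inv_mul_add_mem hr (isOpen_Ioo (a := a) (b := b))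
    (Set.nonempty_Ioo.2 hab)
  refine ⟨y, ?_⟩
  have : Int.fract (r⁻¹ * (y : ℝ)) = r⁻¹ * y + m := by
    rw [← Int.fract_add_intCast _ m]
    exact Int.fract_eq_self.2 ⟨by linarith, by linarith⟩
  rw [this]
  exact ⟨h1, h2⟩

/-- A finite set of points `r⁻¹ m` mod `1` that meets every interval of length at least `δ`. -/
theorem exists_finite_separating (hr : Irrational r) {δ : ℝ} (hδ : 0 < δ) :
    ∃ F : Finset ℤ, ∀ u v : ℝ, 0 ≤ u → v < 1 → δ ≤ v - u →
      ∃ m ∈ F, u < Int.fract (r⁻¹ * m) ∧ Int.fract (r⁻¹ * m) ≤ v := by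
  obtain ⟨N, hN⟩ := exists_nat_gt (2 / δ)
  have hN0 : (0 : ℝ) < N := lt_trans (by positivity) hN
  have hex : ∀ i : Fin N, ∃ m : ℤ, (i : ℝ) / N < Int.fract (r⁻¹ * m) ∧
      Int.fract (r⁻¹ * m) < ((i : ℝ) + 1) / N := by
    intro i
    refine exists_fract_mem_Ioo hr (by positivity) (by gcongr; linarith) ?_
    rw [div_le_one hN0]
    exact_mod_cast i.2
  choose m hm using hex
  refine ⟨Finset.univ.image m, fun u v hu hv huv => ?_⟩
  have h2 : 2 < δ * N := by rwa [div_lt_iff₀' hδ] at hN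
  have hc : ((⌈u * N⌉₊ : ℕ) : ℝ) < u * N + 1 := Nat.ceil_lt_add_one (by positivity)
  have hc' : u * N ≤ ⌈u * N⌉₊ := Nat.le_ceil _
  have hv' : (⌈u * N⌉₊ : ℝ) + 1 < v * N := by nlinarith
  have hi : ⌈u * N⌉₊ < N := by
    have : (⌈u * N⌉₊ : ℝ) < N := by nlinarith
    exact_mod_cast this
  refine ⟨m ⟨_, hi⟩, Finset.mem_image_of_mem _ (Finset.mem_univ _), ?_, ?_⟩
  · refine lt_of_le_of_lt ?_ (hm ⟨_, hi⟩).1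
    rw [le_div_iff₀ hN0]
    exact hc'
  · refine (hm ⟨_, hi⟩).2.le.trans ?_
    rw [div_le_iff₀ hN0]
    exact hv'.le

/-- Around `0` the set `P_r` has a gap longer than everywhere else: `0` is the only integer `y`
such that none of `y - ⌊r⌋, …, y + ⌊r⌋ - 1` lies in `P_r`. -/
theorem eq_zero_iff_forall_notMem (hr : Irrational r) (hr1 : 1 < r) (y : ℤ) :
    y = 0 ↔ ∀ m ∈ Finset.Ico (-⌊r⌋) ⌊r⌋, y + m ∉ beattySet r := by
  have h0 : 0 < r := by linarith
  have hR : (⌊r⌋ : ℝ) < r := lt_of_le_of_ne (Int.floor_le r) fun h => hr.ne_int _ h.symm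
  have hR' := Int.lt_floor_add_one r
  have hR1 : (1 : ℤ) ≤ ⌊r⌋ := Int.le_floor.2 (by exact_mod_cast hr1.le)
  constructor
  · rintro rfl m hm ⟨n, hn, e⟩
    rw [Finset.mem_Ico] at hm
    obtain ⟨h1, h2⟩ := Int.floor_eq_iff.1 e.symm
    rw [zero_add] at h1 h2
    rcases lt_or_gt_of_ne hn with h | h
    · have h' : (n : ℝ) ≤ -1 := by exact_mod_cast (by omega : n ≤ -1)
      have h3 : (-⌊r⌋ : ℝ) ≤ m := by exact_mod_cast hm.1
      have h4 : (m : ℝ) < -⌊r⌋ := by nlinarith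
      linarith
    · have h' : (1 : ℝ) ≤ n := by exact_mod_cast (by omega : 1 ≤ n)
      have h3 : (m : ℝ) + 1 ≤ ⌊r⌋ := by exact_mod_cast hm.2
      nlinarith
  · intro h
    by_contra hy
    rcases lt_or_gt_of_ne hy with hy | hy
    · have hy' : (y : ℝ) ≤ -1 := by exact_mod_cast (by omega : y ≤ -1)
      -- the smallest `n` with `y - ⌊r⌋ ≤ n r` is `⌈c⌉`
      set c := ((y - ⌊r⌋ : ℤ) : ℝ) / r with hc
      have h1 := Int.le_ceil c
      have h2 := Int.ceil_lt_add_one c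
      have e : c * r = y - ⌊r⌋ := by rw [hc]; push_cast; field_simp
      have h3 : (y : ℝ) - ⌊r⌋ ≤ ⌈c⌉ * r := by rw [← e]; gcongr
      have h4 : (⌈c⌉ : ℝ) * r < y + 1 := by nlinarith
      have h5 : ⌊(⌈c⌉ : ℝ) * r⌋ < y + 1 := Int.floor_lt.2 (by exact_mod_cast h4)
      have h6 : y - ⌊r⌋ ≤ ⌊(⌈c⌉ : ℝ) * r⌋ := Int.le_floor.2 (by exact_mod_cast h3)
      refine h (⌊(⌈c⌉ : ℝ) * r⌋ - y) (Finset.mem_Ico.2 ⟨by omega, by omega⟩) ⟨⌈c⌉, ?_, by ring⟩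
      intro h7
      rw [h7] at h4
      norm_num at h4
      linarith
    · have hy' : (1 : ℝ) ≤ y := by exact_mod_cast (by omega : 1 ≤ y)
      -- the largest `n` with `n r < y + ⌊r⌋` is `⌈c⌉ - 1`
      set c := ((y + ⌊r⌋ : ℤ) : ℝ) / r with hc
      have h1 := Int.le_ceil c
      have h2 := Int.ceil_lt_add_one c
      have e : c * r = y + ⌊r⌋ := by rw [hc]; push_cast; field_simp
      have h3 : ((⌈c⌉ - 1 : ℤ) : ℝ) * r < y + ⌊r⌋ := by rw [← e]; push_cast; nlinarith
      have h4 : (y : ℝ) - 1 ≤ ((⌈c⌉ - 1 : ℤ) : ℝ) * r := by push_cast; nlinarith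
      have h5 : ⌊((⌈c⌉ - 1 : ℤ) : ℝ) * r⌋ < y + ⌊r⌋ := Int.floor_lt.2 (by exact_mod_cast h3)
      have h6 : y - 1 ≤ ⌊((⌈c⌉ - 1 : ℤ) : ℝ) * r⌋ := Int.le_floor.2 (by exact_mod_cast h4)
      refine h (⌊((⌈c⌉ - 1 : ℤ) : ℝ) * r⌋ - y) (Finset.mem_Ico.2 ⟨by omega, by omega⟩)
        ⟨⌈c⌉ - 1, ?_, by ring⟩
      intro h7
      have h8 : (⌈c⌉ : ℝ) = 1 := by exact_mod_cast (by omega : ⌈c⌉ = 1)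
      rw [h8] at h1
      nlinarith

/-- Fourier–Motzkin elimination of one variable from finitely many strict inequalities. -/
theorem exists_forall_pos_iff {ι : Type*} [Fintype ι] (p k : ι → ℝ) :
    (∃ β : ℝ, ∀ e, 0 < p e + k e * β) ↔
      (∀ e, k e = 0 → 0 < p e) ∧
        ∀ e e', 0 < k e → k e' < 0 → 0 < p e * (-k e') + p e' * k e := by
  classical
  constructor
  · rintro ⟨β, h⟩
    refine ⟨fun e he => by simpa [he] using h e, fun e e' he he' => ?_⟩
    nlinarith [mul_pos (h e) (neg_pos.2 he'), mul_pos (h e') he]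
  · rintro ⟨h0, h⟩
    obtain ⟨β, hlo, hhi⟩ := Order.exists_between_finsets
      ((Finset.univ.filter fun e => 0 < k e).image fun e => -p e / k e)
      ((Finset.univ.filter fun e => k e < 0).image fun e => p e / -k e) (by
        intro x hx y hy
        simp only [Finset.mem_image, Finset.mem_filter, Finset.mem_univ, true_and] at hx hy
        obtain ⟨e, he, rfl⟩ := hx
        obtain ⟨e', he', rfl⟩ := hy
        rw [div_lt_div_iff₀ he (neg_pos.2 he')]
        linarith [h e e' he he'])
    refine ⟨β, fun e => ?_⟩
    rcases lt_trichotomy (k e) 0 with hk | hk | hk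
    · have := hhi (p e / -k e) (Finset.mem_image_of_mem _ (by simpa using hk))
      rw [lt_div_iff₀ (neg_pos.2 hk)] at this
      linarith
    · simpa [hk] using h0 e hk
    · have := hlo (-p e / k e) (Finset.mem_image_of_mem _ (by simpa using hk))
      rw [div_lt_iff₀ hk] at this
      linarith

end Arith

/-! ### Quantifier-free definable sets of integers -/

section Definable

variable (r : ℝ) {n : ℕ}

/-- The function `f : ℤⁿ → ℤ` is given by an `L_P`-term. -/
def IsTermFun (f : (Fin n → ℤ) → ℤ) : Prop :=
  ∃ t : langP.Term (Empty ⊕ Fin n), ∀ x : Fin n → BeattyInt r,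
    t.realize (Sum.elim default x) = (f x : BeattyInt r)

/-- The subset `S` of `ℤⁿ` is defined in `(ℤ, +, -, 0, 1, P_r)` by a quantifier-free formula with
written out predicates `D_{m,+}` and `D_{m,-}`. -/
def IsQFDefinable (S : (Fin n → ℤ) → Prop) : Prop :=
  ∃ ψ : langP.BoundedFormula Empty n, IsQFWithDiv ψ ∧
    ∀ x : Fin n → BeattyInt r, ψ.Realize default x ↔ S x

variable {r}

namespace IsTermFun

theorem var (i : Fin n) : IsTermFun r fun x => x i :=
  ⟨&i, fun _ => rfl⟩

theorem add {f g : (Fin n → ℤ) → ℤ} (hf : IsTermFun r f) (hg : IsTermFun r g) :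
    IsTermFun r fun x => f x + g x := by
  obtain ⟨s, hs⟩ := hf
  obtain ⟨t, ht⟩ := hg
  exact ⟨addTerm s t, fun x => by rw [realize_addTerm, hs, ht]; rfl⟩

theorem neg {f : (Fin n → ℤ) → ℤ} (hf : IsTermFun r f) : IsTermFun r fun x => -f x := by
  obtain ⟨s, hs⟩ := hf
  exact ⟨negTerm s, fun x => by rw [realize_negTerm, hs]; rfl⟩

theorem sub {f g : (Fin n → ℤ) → ℤ} (hf : IsTermFun r f) (hg : IsTermFun r g) :
    IsTermFun r fun x => f x - g x := by
  simpa only [sub_eq_add_neg] using hf.add hg.neg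

theorem const_mul (k : ℤ) {f : (Fin n → ℤ) → ℤ} (hf : IsTermFun r f) :
    IsTermFun r fun x => k * f x := by
  obtain ⟨s, hs⟩ := hf
  refine ⟨zsmulTerm k s, fun x => ?_⟩
  rw [realize_zsmulTerm, hs]
  exact zsmul_eq_mul (f x : ℤ) k

theorem const (k : ℤ) : IsTermFun r fun _ : Fin n → ℤ => k := by
  have h : IsTermFun r fun _ : Fin n → ℤ => (1 : ℤ) :=
    ⟨oneTerm, fun x => realize_oneTerm _⟩
  simpa using h.const_mul k

end IsTermFun

theorem toInt_nsmul (m : ℕ) (y : BeattyInt r) : (m • y).toInt = (m : ℤ) * y.toInt :=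
  nsmul_eq_mul m y.toInt

namespace IsQFDefinable

variable {S S' : (Fin n → ℤ) → Prop}

theorem congr (hS : IsQFDefinable r S) (h : ∀ x, S x ↔ S' x) : IsQFDefinable r S' := by
  obtain ⟨ψ, h1, h2⟩ := hS
  exact ⟨ψ, h1, fun x => (h2 x).trans (h x)⟩

theorem false : IsQFDefinable r fun _ : Fin n → ℤ => False :=
  ⟨_, .falsum, fun _ => Iff.rfl⟩

theorem imp (hS : IsQFDefinable r S) (hS' : IsQFDefinable r S') :
    IsQFDefinable r fun x => S x → S' x := by
  obtain ⟨ψ, h1, h2⟩ := hS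
  obtain ⟨ψ', h1', h2'⟩ := hS'
  exact ⟨ψ.imp ψ', h1.imp h1', fun x => by rw [BoundedFormula.realize_imp, h2, h2']⟩

theorem not (hS : IsQFDefinable r S) : IsQFDefinable r fun x => ¬ S x :=
  hS.imp false

theorem true : IsQFDefinable r fun _ : Fin n → ℤ => True :=
  false.not.congr fun _ => by tauto

theorem const (p : Prop) : IsQFDefinable r fun _ : Fin n → ℤ => p := by
  by_cases hp : p
  · exact true.congr fun _ => by simp [hp]
  · exact false.congr fun _ => by simp [hp]

theorem and (hS : IsQFDefinable r S) (hS' : IsQFDefinable r S') :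
    IsQFDefinable r fun x => S x ∧ S' x :=
  (hS.imp hS'.not).not.congr fun _ => by tauto

theorem or (hS : IsQFDefinable r S) (hS' : IsQFDefinable r S') :
    IsQFDefinable r fun x => S x ∨ S' x :=
  (hS.not.imp hS').congr fun _ => by tauto

theorem iff (hS : IsQFDefinable r S) (hS' : IsQFDefinable r S') :
    IsQFDefinable r fun x => (S x ↔ S' x) :=
  ((hS.imp hS').and (hS'.imp hS)).congr fun _ => by tauto

theorem exists_mem {β : Type*} {S : β → (Fin n → ℤ) → Prop} (s : Finset β)
    (h : ∀ b ∈ s, IsQFDefinable r (S b)) : IsQFDefinable r fun x => ∃ b ∈ s, S b x := by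
  classical
  induction s using Finset.induction_on with
  | empty => exact false.congr fun _ => by simp
  | insert b s _ ih =>
    refine ((h b (Finset.mem_insert_self b s)).or
      (ih fun c hc => h c (Finset.mem_insert_of_mem hc))).congr fun _ => ?_
    simp

theorem forall_mem {β : Type*} {S : β → (Fin n → ℤ) → Prop} (s : Finset β)
    (h : ∀ b ∈ s, IsQFDefinable r (S b)) : IsQFDefinable r fun x => ∀ b ∈ s, S b x :=
  (exists_mem s fun b hb => (h b hb).not).not.congr fun _ => by simp

theorem exists_fintype {β : Type*} [Fintype β] {S : β → (Fin n → ℤ) → Prop}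
    (h : ∀ b, IsQFDefinable r (S b)) : IsQFDefinable r fun x => ∃ b, S b x :=
  (exists_mem Finset.univ fun b _ => h b).congr fun _ => by simp

theorem forall_fintype {β : Type*} [Fintype β] {S : β → (Fin n → ℤ) → Prop}
    (h : ∀ b, IsQFDefinable r (S b)) : IsQFDefinable r fun x => ∀ b, S b x :=
  (forall_mem Finset.univ fun b _ => h b).congr fun _ => by simp

theorem mem_beatty {f : (Fin n → ℤ) → ℤ} (hf : IsTermFun r f) :
    IsQFDefinable r fun x => f x ∈ beattySet r := by
  obtain ⟨t, ht⟩ := hf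
  refine ⟨memP t, .of_isAtomic (.rel _ _), fun x => ?_⟩
  rw [realize_memP, ht]
  exact inP_beattyInt _

theorem eq_zero {f : (Fin n → ℤ) → ℤ} (hf : IsTermFun r f) :
    IsQFDefinable r fun x => f x = 0 := by
  obtain ⟨t, ht⟩ := hf
  refine ⟨t =' zeroTerm,
    .of_isAtomic (.equal _ _), fun x => ?_⟩
  rw [BoundedFormula.realize_bdEqual, ht, realize_zeroTerm]
  rfl

theorem divPos (m : ℕ+) {f : (Fin n → ℤ) → ℤ} (hf : IsTermFun r f) :
    IsQFDefinable r fun x => ∃ y : ℤ, f x = (m : ℤ) * y ∧ y ∈ beattySet r := by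
  obtain ⟨t, ht⟩ := hf
  refine ⟨BeattyQE.divPos m t, .divPos m t, fun x => ?_⟩
  rw [realize_divPos, ht]
  refine exists_congr fun y => and_congr ?_ Iff.rfl
  exact Eq.congr_right (toInt_nsmul (r := r) m y)

theorem divNeg (m : ℕ+) {f : (Fin n → ℤ) → ℤ} (hf : IsTermFun r f) :
    IsQFDefinable r fun x => ∃ y : ℤ, f x = (m : ℤ) * y ∧ y ∉ beattySet r := by
  obtain ⟨t, ht⟩ := hf
  refine ⟨BeattyQE.divNeg m t, .divNeg m t, fun x => ?_⟩
  rw [realize_divNeg, ht]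
  refine exists_congr fun y => and_congr ?_ Iff.rfl
  exact Eq.congr_right (toInt_nsmul (r := r) m y)

theorem dvd (m : ℕ+) {f : (Fin n → ℤ) → ℤ} (hf : IsTermFun r f) :
    IsQFDefinable r fun x => (m : ℤ) ∣ f x := by
  refine ((divPos m hf).or (divNeg m hf)).congr fun x => ?_
  rw [← exists_or]
  refine exists_congr fun y => ?_
  tauto

/-- A single pattern at the unique solution `y` of a linear equation `f(x) + c y = 0`. -/
theorem exists_pattern_of_linear {f : (Fin n → ℤ) → ℤ} (hf : IsTermFun r f) {c : ℤ} (hc : c ≠ 0)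
    (k : Fin n → ℤ) (I : Finset (Fin n)) : IsQFDefinable r fun x =>
      ∃ y : ℤ, f x + c * y = 0 ∧ ∀ i, x i + k i * y ∈ beattySet r ↔ i ∈ I := by
  -- the equation in the form `m y = g(x)` with `m > 0`
  obtain ⟨m, g, hg, hmg⟩ : ∃ (m : ℕ+) (g : (Fin n → ℤ) → ℤ), IsTermFun r g ∧
      ∀ x y, f x + c * y = 0 ↔ g x = (m : ℤ) * y := by
    rcases lt_or_gt_of_ne hc with h | h
    · refine ⟨⟨c.natAbs, Int.natAbs_pos.2 hc⟩, f, hf, fun x y => ?_⟩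
      have : ((c.natAbs : ℕ) : ℤ) = -c := by omega
      simp only [PNat.mk_coe, this]
      constructor <;> intro h <;> linarith
    · refine ⟨⟨c.natAbs, Int.natAbs_pos.2 hc⟩, fun x => -f x, hf.neg, fun x y => ?_⟩
      have : ((c.natAbs : ℕ) : ℤ) = c := by omega
      simp only [PNat.mk_coe, this]
      constructor <;> intro h <;> linarith
  have hm : (m : ℤ) ≠ 0 := by exact_mod_cast m.ne_zero
  refine ((dvd m hg).and (forall_fintype fun i : Fin n =>
    (divPos m (((IsTermFun.var i).const_mul m).add (hg.const_mul (k i)))).iff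
      (const (i ∈ I)))).congr fun x => ?_
  simp only [hmg]
  constructor
  · rintro ⟨⟨y, hy⟩, h⟩
    refine ⟨y, hy, fun i => ?_⟩
    rw [← h i]
    constructor
    · intro h'
      exact ⟨_, by rw [hy]; ring, h'⟩
    · rintro ⟨z, hz, hzP⟩
      have : z = x i + k i * y := by
        apply mul_left_cancel₀ hm
        rw [← hz, hy]; ring
      exact this ▸ hzP
  · rintro ⟨y, hy, h⟩
    refine ⟨⟨y, hy⟩, fun i => ?_⟩
    rw [← h i]
    constructor
    · rintro ⟨z, hz, hzP⟩
      have : z = x i + k i * y := by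
        apply mul_left_cancel₀ hm
        rw [← hz, hy]; ring
      exact this ▸ hzP
    · intro h'
      exact ⟨_, by rw [hy]; ring, h'⟩

end IsQFDefinable

end Definable

/-! ### Comparing fractional parts -/

section Fract

variable {r : ℝ} {n : ℕ}

theorem fract_lt_inv_iff (hr : Irrational r) (hr1 : 1 < r) (z : ℤ) :
    Int.fract (r⁻¹ * z) < r⁻¹ ↔ z = 0 ∨ z - 1 ∈ beattySet r := by
  have h1 : r⁻¹ < 1 := inv_lt_one_of_one_lt₀ hr1
  have h0 : 0 < r⁻¹ := by positivity
  rw [mem_beattySet_iff_arc hr hr1]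
  constructor
  · intro h
    rw [or_iff_not_imp_left]
    intro hz
    have := (fract_pos_iff hr z).2 hz
    rw [Int.fract] at h this
    exact ⟨⌊r⁻¹ * (z : ℝ)⌋, by push_cast; linarith, by push_cast; linarith⟩
  · rintro (rfl | ⟨j, h2, h3⟩)
    · simpa using h0
    · push_cast at h2 h3
      have : ⌊r⁻¹ * (z : ℝ)⌋ = j := Int.floor_eq_iff.2 ⟨by linarith, by linarith⟩
      rw [Int.fract, this]
      linarith

theorem fract_mul_sub (a b : ℤ) :
    Int.fract (r⁻¹ * ((a - b : ℤ) : ℝ)) = Int.fract (r⁻¹ * a) - Int.fract (r⁻¹ * b) +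
      if Int.fract (r⁻¹ * a) < Int.fract (r⁻¹ * b) then 1 else 0 := by
  have ha := Int.fract_nonneg (r⁻¹ * (a : ℝ))
  have ha' := Int.fract_lt_one (r⁻¹ * (a : ℝ))
  have hb := Int.fract_nonneg (r⁻¹ * (b : ℝ))
  have hb' := Int.fract_lt_one (r⁻¹ * (b : ℝ))
  rw [Int.fract_eq_iff]
  split_ifs with h
  · refine ⟨by linarith, by linarith, ⌊r⁻¹ * (a : ℝ)⌋ - ⌊r⁻¹ * (b : ℝ)⌋ - 1, ?_⟩
    simp only [Int.fract]
    push_cast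
    ring
  · refine ⟨by linarith, by linarith, ⌊r⁻¹ * (a : ℝ)⌋ - ⌊r⁻¹ * (b : ℝ)⌋, ?_⟩
    simp only [Int.fract]
    push_cast
    ring

/-- Carrying in the addition of fractional parts. -/
theorem fract_mul_add (a b : ℤ) :
    Int.fract (r⁻¹ * a) + Int.fract (r⁻¹ * b) = Int.fract (r⁻¹ * ((a + b : ℤ) : ℝ)) +
      if Int.fract (r⁻¹ * ((a + b : ℤ) : ℝ)) < Int.fract (r⁻¹ * b) then 1 else 0 := by
  have := fract_mul_sub (r := r) (a + b) b
  rw [add_sub_cancel_right] at this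
  linarith

namespace IsQFDefinable

/-- The set `{r⁻¹ f(x)} < {r⁻¹ m}` arises from the set for `m + 1` or `m - 1` by adding or
removing an arc of length `r⁻¹`, which is a translate of the one that defines `P_r`. -/
theorem fract_lt_const (hr : Irrational r) (hr1 : 1 < r) {f : (Fin n → ℤ) → ℤ}
    (hf : IsTermFun r f) (m : ℤ) :
    IsQFDefinable r fun x => Int.fract (r⁻¹ * (f x : ℝ)) < Int.fract (r⁻¹ * (m : ℝ)) := by
  have h1 : r⁻¹ < 1 := inv_lt_one_of_one_lt₀ hr1
  have h0 : 0 < r⁻¹ := by positivity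
  have harc : ∀ m : ℤ, IsQFDefinable r fun x => Int.fract (r⁻¹ * ((f x - m : ℤ) : ℝ)) < r⁻¹ :=
    fun m => ((eq_zero (hf.sub (.const m))).or
      (mem_beatty ((hf.sub (.const m)).sub (.const 1)))).congr
      fun x => (fract_lt_inv_iff hr hr1 _).symm
  have hstep : ∀ m : ℤ, Int.fract (r⁻¹ * ((m + 1 : ℤ) : ℝ)) =
      Int.fract (r⁻¹ * (m : ℝ)) + r⁻¹ -
        if Int.fract (r⁻¹ * (m : ℝ)) + r⁻¹ < 1 then 0 else 1 := by
    intro m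
    have ha := Int.fract_nonneg (r⁻¹ * (m : ℝ))
    have ha' := Int.fract_lt_one (r⁻¹ * (m : ℝ))
    rw [Int.fract_eq_iff]
    split_ifs with h
    · refine ⟨by linarith, by linarith, ⌊r⁻¹ * (m : ℝ)⌋, ?_⟩
      simp only [Int.fract]
      push_cast
      ring
    · refine ⟨by linarith, by linarith, ⌊r⁻¹ * (m : ℝ)⌋ + 1, ?_⟩
      simp only [Int.fract]
      push_cast
      ring
  induction m using Int.induction_on with
  | zero =>
    refine false.congr fun x => ?_
    simp
  | succ m ih =>
    by_cases h : Int.fract (r⁻¹ * ((m : ℤ) : ℝ)) + r⁻¹ < 1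
    · refine (ih.or (harc m)).congr fun x => ?_
      have hx := Int.fract_nonneg (r⁻¹ * (f x : ℝ))
      have hx' := Int.fract_lt_one (r⁻¹ * (f x : ℝ))
      have hm := Int.fract_nonneg (r⁻¹ * ((m : ℤ) : ℝ))
      rw [hstep, if_pos h, fract_mul_sub]
      split_ifs with h2
      · exact ⟨fun _ => by linarith, fun _ => Or.inl h2⟩
      · exact ⟨fun h3 => by rcases h3 with h3 | h3 <;> linarith, fun h3 => Or.inr (by linarith)⟩
    · refine (ih.and (harc m)).congr fun x => ?_
      have hx := Int.fract_nonneg (r⁻¹ * (f x : ℝ))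
      have hx' := Int.fract_lt_one (r⁻¹ * (f x : ℝ))
      have hm := Int.fract_lt_one (r⁻¹ * ((m : ℤ) : ℝ))
      rw [hstep, if_neg h, fract_mul_sub]
      split_ifs with h2
      · exact ⟨fun h3 => by linarith [h3.2], fun h3 => ⟨h2, by linarith⟩⟩
      · exact ⟨fun h3 => absurd h3.1 h2, fun h3 => by linarith⟩
  | pred m ih =>
    have hs := hstep (-(m : ℤ) - 1)
    rw [sub_add_cancel] at hs
    set m' : ℤ := -(m : ℤ) - 1
    by_cases h : Int.fract (r⁻¹ * (m' : ℝ)) + r⁻¹ < 1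
    · refine (ih.and (harc m').not).congr fun x => ?_
      have hx := Int.fract_nonneg (r⁻¹ * (f x : ℝ))
      have hx' := Int.fract_lt_one (r⁻¹ * (f x : ℝ))
      have hm := Int.fract_nonneg (r⁻¹ * (m' : ℝ))
      rw [hs, if_pos h, fract_mul_sub (f x) m']
      split_ifs with h2
      · exact ⟨fun _ => h2, fun _ => ⟨by linarith, by linarith⟩⟩
      · exact ⟨fun h3 => absurd (by linarith [h3.1]) h3.2, fun h3 => absurd h3 h2⟩
    · refine (ih.or (harc m').not).congr fun x => ?_
      have hx := Int.fract_nonneg (r⁻¹ * (f x : ℝ))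
      have hx' := Int.fract_lt_one (r⁻¹ * (f x : ℝ))
      have hm := Int.fract_lt_one (r⁻¹ * (m' : ℝ))
      rw [hs, if_neg h, fract_mul_sub (f x) m']
      split_ifs with h2
      · refine ⟨fun _ => h2, fun _ => ?_⟩
        rw [or_iff_not_imp_left]
        intro h3
        linarith
      · exact ⟨fun h3 => by rcases h3 with h3 | h3 <;> linarith, fun h3 => absurd h3 h2⟩

/-- The order of two fractional parts is visible on a finite set of separating points unless the
fractional parts are close to each other, and then it is decided by `P_r`. -/
theorem fract_lt_fract (hr : Irrational r) (hr1 : 1 < r) {f g : (Fin n → ℤ) → ℤ}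
    (hf : IsTermFun r f) (hg : IsTermFun r g) :
    IsQFDefinable r fun x => Int.fract (r⁻¹ * (f x : ℝ)) < Int.fract (r⁻¹ * (g x : ℝ)) := by
  have h1 : r⁻¹ < 1 := inv_lt_one_of_one_lt₀ hr1
  have h0 : 0 < r⁻¹ := by positivity
  obtain ⟨F, hF⟩ := exists_finite_separating hr
    (δ := min r⁻¹ (1 - r⁻¹)) (lt_min h0 (by linarith))
  have hsep : ∀ {f g : (Fin n → ℤ) → ℤ}, IsTermFun r f → IsTermFun r g →
      IsQFDefinable r fun x => ∃ m ∈ F, Int.fract (r⁻¹ * (f x : ℝ)) < Int.fract (r⁻¹ * (m : ℝ)) ∧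
        ¬ Int.fract (r⁻¹ * (g x : ℝ)) < Int.fract (r⁻¹ * (m : ℝ)) :=
    fun hf hg => exists_mem F fun m _ =>
      (fract_lt_const hr hr1 hf m).and (fract_lt_const hr hr1 hg m).not
  refine ((hsep hf hg).or ((hsep hg hf).not.and (mem_beatty (hf.sub hg)))).congr fun x => ?_
  simp only [not_lt]
  have hf0 := Int.fract_nonneg (r⁻¹ * (f x : ℝ))
  have hf1 := Int.fract_lt_one (r⁻¹ * (f x : ℝ))
  have hg0 := Int.fract_nonneg (r⁻¹ * (g x : ℝ))
  have hg1 := Int.fract_lt_one (r⁻¹ * (g x : ℝ))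
  rw [mem_beattySet_iff_fract hr hr1, fract_mul_sub]
  constructor
  · rintro (⟨m, -, h2, h3⟩ | ⟨h2, h3⟩)
    · exact h2.trans_le h3
    · by_contra h4
      rw [if_neg h4] at h3
      refine h2 (hF _ _ hg0 hf1 (le_trans (min_le_right _ _) ?_))
      linarith
  · intro h
    rw [or_iff_not_imp_left, if_pos h]
    intro h2
    refine ⟨?_, ?_⟩
    · rintro ⟨m, -, h3, h4⟩
      exact absurd (h3.trans_le h4) h.not_gt
    · by_contra h3
      exact h2 (hF _ _ hf0 hg1 (le_trans (min_le_left _ _) (by linarith)))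

end IsQFDefinable

/-- A function of the form `{r⁻¹ t(x)} + s(x)`, where `t` is given by a term and `s` takes
finitely many integral values, each on a quantifier-free definable set. -/
def IsTame (r : ℝ) (f : (Fin n → ℤ) → ℝ) : Prop :=
  ∃ (t s : (Fin n → ℤ) → ℤ) (B : Finset ℤ), IsTermFun r t ∧ (∀ x, s x ∈ B) ∧
    (∀ p, IsQFDefinable r fun x => s x = p) ∧ ∀ x, f x = Int.fract (r⁻¹ * (t x : ℝ)) + s x

namespace IsTame

variable {f g : (Fin n → ℤ) → ℝ}

theorem fract {t : (Fin n → ℤ) → ℤ} (ht : IsTermFun r t) :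
    IsTame r fun x => Int.fract (r⁻¹ * (t x : ℝ)) :=
  ⟨t, fun _ => 0, {0}, ht, by simp, fun _ => .const _, by simp⟩

theorem intCast (k : ℤ) : IsTame r fun _ : Fin n → ℤ => (k : ℝ) :=
  ⟨fun _ => 0, fun _ => k, {k}, .const 0, by simp, fun _ => .const _, by simp⟩

theorem add (hr : Irrational r) (hr1 : 1 < r) (hf : IsTame r f) (hg : IsTame r g) :
    IsTame r fun x => f x + g x := by
  classical
  obtain ⟨t, s, B, ht, hB, hs, hf⟩ := hf
  obtain ⟨t', s', B', ht', hB', hs', hg⟩ := hg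
  -- the carry
  set c : (Fin n → ℤ) → ℤ := fun x =>
    if Int.fract (r⁻¹ * ((t x + t' x : ℤ) : ℝ)) < Int.fract (r⁻¹ * (t' x : ℝ)) then 1 else 0
    with hc
  have hcB : ∀ x, c x ∈ ({0, 1} : Finset ℤ) := fun x => by
    simp only [hc]; split_ifs <;> simp
  have hlt := IsQFDefinable.fract_lt_fract hr hr1 (ht.add ht') ht'
  have hcd : ∀ p, IsQFDefinable r fun x => c x = p := fun p => by
    refine ((hlt.and (.const (1 = p))).or (hlt.not.and (.const (0 = p)))).congr fun x => ?_
    simp only [hc]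
    split_ifs with h <;> tauto
  refine ⟨fun x => t x + t' x, fun x => s x + s' x + c x,
    (B ×ˢ B' ×ˢ {0, 1}).image fun q => q.1 + q.2.1 + q.2.2, ht.add ht', fun x => ?_, fun p => ?_,
    fun x => ?_⟩
  · exact Finset.mem_image.2 ⟨(s x, s' x, c x), by
      simp only [Finset.mem_product]
      exact ⟨hB x, hB' x, hcB x⟩, rfl⟩
  · refine (IsQFDefinable.exists_mem ((B ×ˢ B' ×ˢ {0, 1}).filter fun q => q.1 + q.2.1 + q.2.2 = p)
      fun q _ => ((hs q.1).and ((hs' q.2.1).and (hcd q.2.2)))).congr fun x => ?_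
    constructor
    · rintro ⟨q, hq, h1, h2, h3⟩
      dsimp only
      rw [h1, h2, h3]
      exact (Finset.mem_filter.1 hq).2
    · intro h
      refine ⟨(s x, s' x, c x), Finset.mem_filter.2 ⟨?_, h⟩, rfl, rfl, rfl⟩
      simp only [Finset.mem_product]
      exact ⟨hB x, hB' x, hcB x⟩
  · have h := fract_mul_add (r := r) (t x) (t' x)
    have hcx : ((c x : ℤ) : ℝ) =
        if Int.fract (r⁻¹ * ((t x + t' x : ℤ) : ℝ)) < Int.fract (r⁻¹ * (t' x : ℝ)) then 1
        else 0 := by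
      simp only [hc]; split_ifs <;> simp
    rw [← hcx] at h
    dsimp only
    rw [hf, hg]
    push_cast at h ⊢
    linarith

theorem neg (hr : Irrational r) (hf : IsTame r f) : IsTame r fun x => -f x := by
  classical
  obtain ⟨t, s, B, ht, hB, hs, hf⟩ := hf
  refine ⟨fun x => -t x, fun x => if t x = 0 then -s x else -s x - 1,
    B.image (fun p => -p) ∪ B.image (fun p => -p - 1), ht.neg, fun x => ?_, fun p => ?_,
    fun x => ?_⟩
  · dsimp only
    split_ifs
    · exact Finset.mem_union_left _ (Finset.mem_image_of_mem _ (hB x))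
    · exact Finset.mem_union_right _ (Finset.mem_image_of_mem (fun p => -p - 1) (hB x))
  · have h0 := IsQFDefinable.eq_zero ht
    refine ((h0.and (hs (-p))).or (h0.not.and (hs (-p - 1)))).congr fun x => ?_
    dsimp only
    split_ifs with h <;> simp only [h, not_true, not_false_iff, true_and, false_and, or_false,
      false_or] <;> omega
  · dsimp only
    rw [hf]
    split_ifs with h
    · simp [h]
    · have h2 : Int.fract (r⁻¹ * (t x : ℝ)) ≠ 0 := ((fract_pos_iff hr _).2 h).ne'
      have h3 := Int.fract_neg h2
      push_cast
      rw [mul_neg, h3]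
      ring

theorem nsmul (hr : Irrational r) (hr1 : 1 < r) (hf : IsTame r f) (k : ℕ) :
    IsTame r fun x => k * f x := by
  induction k with
  | zero => simpa using intCast (n := n) (r := r) 0
  | succ k ih =>
    have := ih.add hr hr1 hf
    convert this using 2
    push_cast
    ring

theorem intCast_mul (hr : Irrational r) (hr1 : 1 < r) (hf : IsTame r f) (k : ℤ) :
    IsTame r fun x => k * f x := by
  obtain ⟨k, rfl | rfl⟩ := k.eq_nat_or_neg
  · simpa using hf.nsmul hr hr1 k
  · simpa using (hf.nsmul hr hr1 k).neg hr

theorem inv (hr1 : 1 < r) : IsTame r fun _ : Fin n → ℤ => r⁻¹ := by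
  have h := fract (r := r) (n := n) (.const 1)
  have h1 : r⁻¹ < 1 := inv_lt_one_of_one_lt₀ hr1
  have h0 : 0 < r⁻¹ := by positivity
  simpa [Int.fract_eq_self.2 ⟨h0.le, h1⟩] using h

theorem pos (hr : Irrational r) (hf : IsTame r f) : IsQFDefinable r fun x => 0 < f x := by
  obtain ⟨t, s, B, ht, hB, hs, hf⟩ := hf
  refine ((IsQFDefinable.exists_mem (B.filter fun p => 1 ≤ p) fun p _ => hs p).or
    ((hs 0).and (IsQFDefinable.eq_zero ht).not)).congr fun x => ?_
  have h0 := Int.fract_nonneg (r⁻¹ * (t x : ℝ))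
  have h1 := Int.fract_lt_one (r⁻¹ * (t x : ℝ))
  rw [hf]
  constructor
  · rintro (⟨p, hp, h⟩ | ⟨h2, h3⟩)
    · have : (1 : ℝ) ≤ s x := by
        rw [h]; exact_mod_cast (Finset.mem_filter.1 hp).2
      linarith
    · have := (fract_pos_iff hr (t x)).2 h3
      rw [h2]
      simpa using this
  · intro h
    rcases lt_trichotomy (s x) 0 with h2 | h2 | h2
    · have : (s x : ℝ) ≤ -1 := by exact_mod_cast (by omega : s x ≤ -1)
      linarith
    · refine Or.inr ⟨h2, ?_⟩
      rw [h2] at h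
      exact (fract_pos_iff hr (t x)).1 (by simpa using h)
    · exact Or.inl ⟨s x, Finset.mem_filter.2 ⟨hB x, h2⟩, rfl⟩

end IsTame

end Fract

/-! ### Patterns are quantifier-free definable in the integers -/

section Pattern

variable {r : ℝ} {n : ℕ}

/-- For open conditions, an integral solution exists as soon as a real solution exists, and for a
real solution the integral parts are bounded in terms of `k`. -/
theorem exists_int_arc_iff (hr : Irrational r) (a b : Fin n → ℝ) (ha : ∀ i, -1 ≤ a i)
    (hb : ∀ i, b i ≤ 1) (k x : Fin n → ℤ) :
    (∃ y : ℤ, ∀ i, ∃ j : ℤ, a i + j < r⁻¹ * ((x i + k i * y : ℤ) : ℝ) ∧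
      r⁻¹ * ((x i + k i * y : ℤ) : ℝ) < b i + j) ↔
    ∃ j ∈ Fintype.piFinset fun i => Finset.Icc (-(|k i| + 2)) (|k i| + 2),
      ∃ β : ℝ, ∀ i, a i + j i < Int.fract (r⁻¹ * (x i : ℝ)) + k i * β ∧
        Int.fract (r⁻¹ * (x i : ℝ)) + k i * β < b i + j i := by
  constructor
  · rintro ⟨y, h⟩
    choose j hj using h
    have hx : ∀ i, r⁻¹ * ((x i + k i * y : ℤ) : ℝ) = Int.fract (r⁻¹ * (x i : ℝ)) +
        k i * Int.fract (r⁻¹ * (y : ℝ)) +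
          ((⌊r⁻¹ * (x i : ℝ)⌋ + k i * ⌊r⁻¹ * (y : ℝ)⌋ : ℤ) : ℝ) := by
      intro i
      simp only [Int.fract]
      push_cast
      ring
    have key : ∀ i, a i + ((j i - (⌊r⁻¹ * (x i : ℝ)⌋ + k i * ⌊r⁻¹ * (y : ℝ)⌋) : ℤ) : ℝ) <
          Int.fract (r⁻¹ * (x i : ℝ)) + k i * Int.fract (r⁻¹ * (y : ℝ)) ∧
        Int.fract (r⁻¹ * (x i : ℝ)) + k i * Int.fract (r⁻¹ * (y : ℝ)) <
          b i + ((j i - (⌊r⁻¹ * (x i : ℝ)⌋ + k i * ⌊r⁻¹ * (y : ℝ)⌋) : ℤ) : ℝ) := by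
      intro i
      have := hj i
      rw [hx i] at this
      push_cast at this ⊢
      constructor <;> linarith [this.1, this.2]
    refine ⟨fun i => j i - (⌊r⁻¹ * (x i : ℝ)⌋ + k i * ⌊r⁻¹ * (y : ℝ)⌋),
      Fintype.mem_piFinset.2 fun i => ?_, Int.fract (r⁻¹ * (y : ℝ)), key⟩
    obtain ⟨h1, h2⟩ := key i
    have hu0 := Int.fract_nonneg (r⁻¹ * (x i : ℝ))
    have hu1 := Int.fract_lt_one (r⁻¹ * (x i : ℝ))
    have hy0 := Int.fract_nonneg (r⁻¹ * (y : ℝ))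
    have hy1 := Int.fract_lt_one (r⁻¹ * (y : ℝ))
    have hk : |(k i : ℝ) * Int.fract (r⁻¹ * (y : ℝ))| ≤ |(k i : ℝ)| := by
      rw [abs_mul, abs_of_nonneg hy0]
      exact mul_le_of_le_one_right (abs_nonneg _) hy1.le
    obtain ⟨hk1, hk2⟩ := abs_le.1 hk
    have := ha i
    have := hb i
    rw [Finset.mem_Icc]
    constructor
    · have h3 : -(|(k i : ℝ)| + 2) ≤
          ((j i - (⌊r⁻¹ * (x i : ℝ)⌋ + k i * ⌊r⁻¹ * (y : ℝ)⌋) : ℤ) : ℝ) := by linarith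
      exact_mod_cast h3
    · have h3 : ((j i - (⌊r⁻¹ * (x i : ℝ)⌋ + k i * ⌊r⁻¹ * (y : ℝ)⌋) : ℤ) : ℝ) ≤
          |(k i : ℝ)| + 2 := by linarith
      exact_mod_cast h3
  · rintro ⟨j, -, β, hβ⟩
    obtain ⟨y, m, hym⟩ := exists_inv_mul_add_mem hr
      (U := ⋂ i, {β : ℝ | a i + j i < Int.fract (r⁻¹ * (x i : ℝ)) + k i * β} ∩
        {β : ℝ | Int.fract (r⁻¹ * (x i : ℝ)) + k i * β < b i + j i})
      (isOpen_iInter_of_finite fun i =>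
        (isOpen_lt (by fun_prop) (by fun_prop)).inter (isOpen_lt (by fun_prop) (by fun_prop)))
      ⟨β, Set.mem_iInter.2 hβ⟩
    rw [Set.mem_iInter] at hym
    refine ⟨y, fun i => ⟨j i + ⌊r⁻¹ * (x i : ℝ)⌋ - k i * m, ?_⟩⟩
    obtain ⟨h1, h2⟩ := hym i
    simp only [Set.mem_ofPred_eq, Int.fract] at h1 h2
    push_cast
    constructor <;> linarith

namespace IsQFDefinable

/-- Fourier–Motzkin elimination of the real variable in `exists_int_arc_iff`, for each of the
finitely many choices of the integral parts. -/
theorem exists_int_arc (hr : Irrational r) (hr1 : 1 < r) (a b : Fin n → ℝ)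
    (ha : ∀ i, -1 ≤ a i) (hb : ∀ i, b i ≤ 1)
    (ha' : ∀ i, IsTame r fun _ : Fin n → ℤ => a i)
    (hb' : ∀ i, IsTame r fun _ : Fin n → ℤ => b i) (k : Fin n → ℤ) :
    IsQFDefinable r fun x : Fin n → ℤ => ∃ y : ℤ, ∀ i, ∃ j : ℤ,
      a i + j < r⁻¹ * ((x i + k i * y : ℤ) : ℝ) ∧
        r⁻¹ * ((x i + k i * y : ℤ) : ℝ) < b i + j := by
  -- for fixed `j`, the two inequalities for every `i` as positivity of `p e + k e * β`
  let p (j : Fin n → ℤ) (x : Fin n → ℤ) : Fin n ⊕ Fin n → ℝ :=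
    Sum.elim (fun i => Int.fract (r⁻¹ * (x i : ℝ)) + -(a i + (j i : ℝ)))
      (fun i => (b i + (j i : ℝ)) + -Int.fract (r⁻¹ * (x i : ℝ)))
  let c : Fin n ⊕ Fin n → ℤ := Sum.elim k fun i => -k i
  have hp : ∀ j e, IsTame r fun x => p j x e := by
    intro j e
    rcases e with i | i
    · exact (IsTame.fract (.var i)).add hr hr1 (((ha' i).add hr hr1 (.intCast _)).neg hr)
    · exact ((hb' i).add hr hr1 (.intCast _)).add hr hr1 ((IsTame.fract (.var i)).neg hr)
  have main : ∀ j : Fin n → ℤ, IsQFDefinable r fun x =>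
      ∃ β : ℝ, ∀ e, 0 < p j x e + (c e : ℝ) * β := by
    intro j
    refine ((forall_fintype fun e : Fin n ⊕ Fin n =>
      (const (r := r) ((c e : ℝ) = 0)).imp ((hp j e).pos hr)).and
      (forall_fintype fun e : Fin n ⊕ Fin n => forall_fintype fun e' : Fin n ⊕ Fin n =>
        (const (r := r) (0 < (c e : ℝ))).imp ((const (r := r) ((c e' : ℝ) < 0)).imp
          ((((hp j e).intCast_mul hr hr1 (-c e')).add hr hr1
            ((hp j e').intCast_mul hr hr1 (c e))).pos hr)))).congr fun x => ?_
    rw [exists_forall_pos_iff]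
    push_cast
    simp only [mul_comm]
  refine (exists_mem (Fintype.piFinset fun i => Finset.Icc (-(|k i| + 2)) (|k i| + 2))
    fun j _ => main j).congr fun x => ?_
  rw [exists_int_arc_iff hr a b ha hb]
  refine exists_congr fun j => and_congr Iff.rfl (exists_congr fun β => ?_)
  simp only [Sum.forall, p, c, Sum.elim_inl, Sum.elim_inr, ← forall_and]
  refine forall_congr' fun i => ?_
  push_cast
  constructor <;> rintro ⟨h1, h2⟩ <;> constructor <;> linarith

/-- A solution of a pattern either solves one of the equations `x_i + k_i y = 0` and
`x_i + k_i y = -1` with `i ∉ I` and `k_i ≠ 0`, or it solves a system of open conditions. -/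
theorem exists_pattern (hr : Irrational r) (hr1 : 1 < r) (k : Fin n → ℤ) (I : Finset (Fin n)) :
    IsQFDefinable r fun x : Fin n → ℤ =>
      ∃ y : ℤ, ∀ i, x i + k i * y ∈ beattySet r ↔ i ∈ I := by
  have h1 : r⁻¹ < 1 := inv_lt_one_of_one_lt₀ hr1
  have h0 : 0 < r⁻¹ := by positivity
  -- the arc `(-1, 1)` imposes no condition modulo `1`
  let a : Fin n → ℝ := fun i => if i ∈ I then -r⁻¹ else if k i = 0 then -1 else 0
  let b : Fin n → ℝ := fun i => if i ∈ I then 0 else if k i = 0 then 1 else 1 - r⁻¹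
  have hinv : IsTame r fun _ : Fin n → ℤ => r⁻¹ := IsTame.inv hr1
  have hopen := exists_int_arc (n := n) hr hr1 a b
    (fun i => by simp only [a]; split_ifs <;> linarith)
    (fun i => by simp only [b]; split_ifs <;> linarith)
    (fun i => by
      simp only [a]
      split_ifs
      · exact hinv.neg hr
      · simpa using IsTame.intCast (r := r) (n := n) (-1)
      · simpa using IsTame.intCast (r := r) (n := n) 0)
    (fun i => by
      simp only [b]
      split_ifs
      · simpa using IsTame.intCast (r := r) (n := n) 0
      · simpa using IsTame.intCast (r := r) (n := n) 1
      · simpa [sub_eq_add_neg] using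
          (IsTame.intCast (r := r) (n := n) 1).add hr hr1 (hinv.neg hr)) k
  have hconst : IsQFDefinable r fun x : Fin n → ℤ =>
      ∀ i, (i ∉ I ∧ k i = 0) → x i ∉ beattySet r :=
    forall_fintype fun i => (const _).imp (mem_beatty (.var i)).not
  have hbdry : IsQFDefinable r fun x : Fin n → ℤ => ∃ i, k i ≠ 0 ∧ ∃ ε ∈ ({0, 1} : Finset ℤ),
      ∃ y : ℤ, (x i + ε) + k i * y = 0 ∧ ∀ l, x l + k l * y ∈ beattySet r ↔ l ∈ I := by
    refine exists_fintype fun i => ?_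
    by_cases hk : k i = 0
    · exact false.congr fun _ => by simp [hk]
    · refine (exists_mem {0, 1} fun ε _ => exists_pattern_of_linear
        ((IsTermFun.var i).add (.const ε)) hk k I).congr fun _ => by simp [hk]
  refine ((hconst.and hopen).or hbdry).congr fun x => ?_
  constructor
  · rintro (⟨hc, y, hy⟩ | ⟨i, -, ε, -, y, -, hy⟩)
    · refine ⟨y, fun i => ?_⟩
      obtain ⟨j, hj1, hj2⟩ := hy i
      by_cases hi : i ∈ I
      · simp only [a, b, if_pos hi, zero_add] at hj1 hj2
        simp only [hi, iff_true]
        exact (mem_beattySet_iff_arc hr hr1 _).2 ⟨j, hj1, hj2⟩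
      · simp only [hi, iff_false]
        by_cases hk : k i = 0
        · simpa [hk] using hc i ⟨hi, hk⟩
        · simp only [a, b, if_neg hi, if_neg hk] at hj1 hj2
          -- the open arc `(0, 1 - r⁻¹)` lies in the arc that defines the complement
          rw [mem_beattySet_iff_fract hr hr1, not_lt]
          have : ⌊r⁻¹ * ((x i + k i * y : ℤ) : ℝ)⌋ = j :=
            Int.floor_eq_iff.2 ⟨by linarith, by linarith⟩
          rw [Int.fract, this]
          linarith
    · exact ⟨y, hy⟩
  · rintro ⟨y, hy⟩
    rw [or_iff_not_imp_right]
    intro hnb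
    refine ⟨fun i hi => ?_, y, fun i => ?_⟩
    · have := (hy i).not.2 hi.1
      simpa [hi.2] using this
    · by_cases hi : i ∈ I
      · obtain ⟨j, hj1, hj2⟩ := (mem_beattySet_iff_arc hr hr1 _).1 ((hy i).2 hi)
        refine ⟨j, ?_, ?_⟩
        · simpa only [a, if_pos hi] using hj1
        · simpa only [b, if_pos hi, zero_add] using hj2
      · by_cases hk : k i = 0
        · refine ⟨⌊r⁻¹ * ((x i + k i * y : ℤ) : ℝ)⌋, ?_, ?_⟩
          · simp only [a, if_neg hi, if_pos hk]
            linarith [Int.floor_le (r⁻¹ * ((x i + k i * y : ℤ) : ℝ))]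
          · simp only [b, if_neg hi, if_pos hk]
            linarith [Int.lt_floor_add_one (r⁻¹ * ((x i + k i * y : ℤ) : ℝ))]
        · have hne : ∀ ε ∈ ({0, 1} : Finset ℤ), x i + ε + k i * y ≠ 0 :=
            fun ε hε h => hnb ⟨i, hk, ε, hε, y, h, hy⟩
          have hne0 := hne 0 (by simp)
          have hne1 := hne 1 (by simp)
          obtain ⟨j, hj1, hj2⟩ := (notMem_beattySet_iff_arc hr hr1 _ (by omega) (by omega)).1
            ((hy i).not.2 hi)
          refine ⟨j, ?_, ?_⟩
          · simpa only [a, if_neg hi, if_neg hk] using hj1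
          · simpa only [b, if_neg hi, if_neg hk] using hj2

end IsQFDefinable

end Pattern

/-! ### The family of quantifier-free formulas -/

section Family

variable {n : ℕ}

namespace IsQFWithDiv

variable {φ ψ : langP.BoundedFormula Empty n}

theorem not (h : IsQFWithDiv φ) : IsQFWithDiv φ.not :=
  h.imp .falsum

theorem inf (h : IsQFWithDiv φ) (h' : IsQFWithDiv ψ) : IsQFWithDiv (φ ⊓ ψ) :=
  (h.imp h'.not).not

theorem iff (h : IsQFWithDiv φ) (h' : IsQFWithDiv ψ) : IsQFWithDiv (φ.iff ψ) :=
  (h.imp h').inf (h'.imp h)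

theorem iInf {β : Type} [Finite β] {f : β → langP.BoundedFormula Empty n}
    (h : ∀ b, IsQFWithDiv (f b)) : IsQFWithDiv (BoundedFormula.iInf f) := by
  have key : ∀ l : List β, IsQFWithDiv ((l.map f).foldr (· ⊓ ·) ⊤) := by
    intro l
    induction l with
    | nil => exact IsQFWithDiv.falsum.not
    | cons b l ih => exact (h b).inf ih
  exact key _

end IsQFWithDiv

/-- The `i`-th variable is zero if and only if none of `x_i - R, …, x_i + R - 1` lies in `P`. -/
noncomputable def gapFormula (R : ℤ) (i : Fin n) : langP.BoundedFormula Empty n :=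
  ((&i) =' zeroTerm).iff
    (BoundedFormula.iInf fun m : Finset.Ico (-R) R =>
      ∼(memP (addTerm (&i) (zsmulTerm m oneTerm))))

theorem isQFWithDiv_gapFormula (R : ℤ) (i : Fin n) : IsQFWithDiv (gapFormula R i) :=
  (IsQFWithDiv.of_isAtomic (.equal _ _)).iff
    (.iInf fun _ => (IsQFWithDiv.of_isAtomic (.rel _ _)).not)

theorem realize_gapFormula {M : Type} [langP.Structure M] [AddCommGroup M] [One M]
    [IsGroupStructure M] (R : ℤ) (i : Fin n) (v : Empty → M) (x : Fin n → M) :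
    (gapFormula R i).Realize v x ↔
      (x i = 0 ↔ ∀ m ∈ Finset.Ico (-R) R, ¬ InP (x i + m • (1 : M))) := by
  simp only [gapFormula, BoundedFormula.realize_iff, BoundedFormula.realize_bdEqual,
    BoundedFormula.realize_iInf, BoundedFormula.realize_not, realize_memP, realize_addTerm,
    realize_zsmulTerm, realize_oneTerm, realize_zeroTerm, Subtype.forall]
  rfl

variable {r : ℝ}

theorem toInt_add_zsmul_one (z : BeattyInt r) (m : ℤ) :
    (z + m • (1 : BeattyInt r)).toInt = z.toInt + m := by
  change (z.toInt + m • (1 : ℤ) : ℤ) = _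
  simp

theorem realize_gapFormula_floor (hr : Irrational r) (hr1 : 1 < r) (i : Fin n)
    (x : Fin n → BeattyInt r) : (gapFormula ⌊r⌋ i).Realize default x := by
  rw [realize_gapFormula]
  refine (eq_zero_iff_forall_notMem hr hr1 (x i).toInt).trans
    (forall₂_congr fun m _ => not_congr ?_)
  rw [inP_beattyInt, toInt_add_zsmul_one]

/-- All formulas of the family imply the formulas `gapFormula R i`. In the models of the theory
of the family, `0` is then described in terms of `P`. -/
def ImpliesGap (ψ : PatternFamily) (R : ℤ) : Prop :=
  ∀ (n : ℕ) (k : Fin n → ℤ) (I : Finset (Fin n)) (M : Type) [langP.Structure M]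
    (x : Fin n → M), (ψ n k I).Realize default x → ∀ i, (gapFormula R i).Realize default x

/-- Every pattern formula is equivalent in the integers to a quantifier-free formula. This formula
can be chosen to imply the formulas `gapFormula ⌊r⌋ i`, because these are valid in the integers;
in this way the description of `0` in terms of `P` becomes a consequence of the theory. -/
theorem exists_patternFamily (hr : Irrational r) (hr1 : 1 < r) :
    ∃ ψ : PatternFamily, (∀ (n : ℕ) (k : Fin n → ℤ) (I : Finset (Fin n)),
      IsQFWithDiv (ψ n k I) ∧ BeattyInt r ⊨ patternSentence k I (ψ n k I)) ∧
      ImpliesGap ψ ⌊r⌋ := by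
  have h := fun (n : ℕ) (k : Fin n → ℤ) (I : Finset (Fin n)) =>
    IsQFDefinable.exists_pattern hr hr1 k I
  choose ψ hψ hx using h
  refine ⟨fun n k I => ψ n k I ⊓ BoundedFormula.iInf fun i => gapFormula ⌊r⌋ i,
    fun n k I => ⟨(hψ n k I).inf (.iInf fun i => isQFWithDiv_gapFormula _ i), ?_⟩, ?_⟩
  · rw [realize_patternSentence]
    intro x
    rw [BoundedFormula.realize_inf, BoundedFormula.realize_iInf,
      and_iff_left fun i => realize_gapFormula_floor hr hr1 i x]
    exact (hx n k I x).symm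
  · intro n k I M _ x h i
    rw [BoundedFormula.realize_inf, BoundedFormula.realize_iInf] at h
    exact h.2 i

end Family

/-! ### Models of the theory of the group of integers -/

section GroupModel

/-- The term `0` of the language of groups. -/
def groupZero {α : Type} : groupLang.Term α :=
  Constants.term (L := groupLang) GroupFunc.zero

/-- The term `-t` of the language of groups. -/
def groupNeg {α : Type} (t : groupLang.Term α) : groupLang.Term α :=
  Functions.apply₁ (L := groupLang) GroupFunc.neg t

/-- The term `s + t` of the language of groups. -/
def groupAdd {α : Type} (s t : groupLang.Term α) : groupLang.Term α :=
  Functions.apply₂ (L := groupLang) GroupFunc.add s t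

/-- The term `k t` of the language of groups. -/
def groupNsmul {α : Type} : ℕ → groupLang.Term α → groupLang.Term α
  | 0, _ => groupZero
  | k + 1, t => groupAdd (groupNsmul k t) t

variable {M : Type} [groupLang.Structure M]

theorem realize_of_int (hM : M ⊨ groupLang.completeTheory ℤ) (σ : groupLang.Sentence)
    (h : ℤ ⊨ σ) : M ⊨ σ :=
  (Theory.model_iff _).1 hM σ ((mem_completeTheory (L := groupLang) (M := ℤ)).2 h)

/-- An equation that holds identically in `ℤ` holds identically in `M`. -/
theorem identity_of_int (hM : M ⊨ groupLang.completeTheory ℤ) {n : ℕ}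
    (s t : groupLang.Term (Empty ⊕ Fin n))
    (h : ∀ (v : Empty → ℤ) (x : Fin n → ℤ),
      s.realize (Sum.elim v x) = t.realize (Sum.elim v x))
    (x : Fin n → M) : s.realize (Sum.elim default x) = t.realize (Sum.elim default x) := by
  have := realize_of_int hM (s =' t).alls (by
    rw [Sentence.Realize, BoundedFormula.realize_alls]
    intro x
    rw [BoundedFormula.realize_bdEqual]
    exact h _ x)
  rw [Sentence.Realize, BoundedFormula.realize_alls] at this
  exact BoundedFormula.realize_bdEqual _ _ |>.1 (this x)

theorem realize_groupZero {α : Type} (v : α → M) :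
    (groupZero : groupLang.Term α).realize v =
      Structure.funMap (L := groupLang) GroupFunc.zero ![] := by
  rw [groupZero, Constants.term, Term.realize_func]
  congr 1
  exact Subsingleton.elim _ _

theorem realize_groupNeg {α : Type} (t : groupLang.Term α) (v : α → M) :
    (groupNeg t).realize v = Structure.funMap (L := groupLang) GroupFunc.neg ![t.realize v] :=
  Term.realize_functions_apply₁

theorem realize_groupAdd {α : Type} (s t : groupLang.Term α) (v : α → M) :
    (groupAdd s t).realize v =
      Structure.funMap (L := groupLang) GroupFunc.add ![s.realize v, t.realize v] :=
  Term.realize_functions_apply₂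

variable (M) in
/-- The abelian group underlying a model of the theory of `(ℤ, +, -, 0, 1)`. -/
@[reducible] def groupOfModel (hM : M ⊨ groupLang.completeTheory ℤ) : AddCommGroup M where
  add a b := Structure.funMap (L := groupLang) GroupFunc.add ![a, b]
  zero := Structure.funMap (L := groupLang) GroupFunc.zero ![]
  neg a := Structure.funMap (L := groupLang) GroupFunc.neg ![a]
  nsmul := @nsmulRec M ⟨Structure.funMap (L := groupLang) GroupFunc.zero ![]⟩
    ⟨fun a b => Structure.funMap (L := groupLang) GroupFunc.add ![a, b]⟩
  zsmul := @zsmulRec M ⟨Structure.funMap (L := groupLang) GroupFunc.zero ![]⟩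
    ⟨fun a b => Structure.funMap (L := groupLang) GroupFunc.add ![a, b]⟩
    ⟨fun a => Structure.funMap (L := groupLang) GroupFunc.neg ![a]⟩
    (@nsmulRec M ⟨Structure.funMap (L := groupLang) GroupFunc.zero ![]⟩
    ⟨fun a b => Structure.funMap (L := groupLang) GroupFunc.add ![a, b]⟩)
  add_assoc a b c := by
    have := identity_of_int hM (n := 3) (groupAdd (groupAdd (&0) (&1)) (&2))
      (groupAdd (&0) (groupAdd (&1) (&2)))
      (fun _ x => by simp only [realize_groupAdd]; exact add_assoc _ _ _) ![a, b, c]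
    simp only [realize_groupAdd] at this
    exact this
  add_comm a b := by
    have := identity_of_int hM (n := 2) (groupAdd (&0) (&1)) (groupAdd (&1) (&0))
      (fun _ x => by simp only [realize_groupAdd]; exact add_comm _ _) ![a, b]
    simp only [realize_groupAdd] at this
    exact this
  zero_add a := by
    have := identity_of_int hM (n := 1) (groupAdd groupZero (&0)) (&0)
      (fun _ x => by simp only [realize_groupAdd, realize_groupZero]; exact zero_add _) ![a]
    simp only [realize_groupAdd, realize_groupZero] at this
    exact this
  add_zero a := by
    have := identity_of_int hM (n := 1) (groupAdd (&0) groupZero) (&0)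
      (fun _ x => by simp only [realize_groupAdd, realize_groupZero]; exact add_zero _) ![a]
    simp only [realize_groupAdd, realize_groupZero] at this
    exact this
  neg_add_cancel a := by
    have := identity_of_int hM (n := 1) (groupAdd (groupNeg (&0)) (&0)) groupZero
      (fun _ x => by
        simp only [realize_groupAdd, realize_groupZero, realize_groupNeg]
        exact neg_add_cancel _) ![a]
    simp only [realize_groupAdd, realize_groupZero, realize_groupNeg] at this
    exact this

/-- The distinguished element of a structure for the language of groups. -/
@[reducible] def oneOfModel (M : Type) [groupLang.Structure M] : One M :=
  ⟨Structure.funMap (L := groupLang) GroupFunc.one ![]⟩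

theorem realize_groupNsmul (hM : M ⊨ groupLang.completeTheory ℤ) {α : Type} (k : ℕ)
    (t : groupLang.Term α) (v : α → M) :
    letI := groupOfModel M hM
    (groupNsmul k t).realize v = k • t.realize v := by
  let := groupOfModel M hM
  change _ = k • t.realize v
  induction k with
  | zero =>
    rw [groupNsmul, realize_groupZero, zero_smul]
    rfl
  | succ k ih =>
    rw [groupNsmul, realize_groupAdd, ih, succ_nsmul]
    rfl

theorem realize_groupNsmul_int {α : Type} (k : ℕ) (t : groupLang.Term α) (v : α → ℤ) :
    (groupNsmul k t).realize v = k * t.realize v := by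
  induction k with
  | zero =>
    rw [groupNsmul, realize_groupZero, Nat.cast_zero, zero_mul]
    rfl
  | succ k ih =>
    rw [groupNsmul, realize_groupAdd, ih, Nat.cast_succ, add_mul, one_mul]
    rfl

theorem torsionFree_of_model (hM : M ⊨ groupLang.completeTheory ℤ) (k : ℕ) (hk : k ≠ 0)
    (a : M) :
    letI := groupOfModel M hM
    k • a = 0 → a = 0 := by
  let := groupOfModel M hM
  change k • a = 0 → a = 0
  have h := realize_of_int hM
    (((groupNsmul k (&0)) =' groupZero).imp ((&0) =' groupZero) :
      groupLang.BoundedFormula Empty 1).alls (by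
      rw [Sentence.Realize, BoundedFormula.realize_alls]
      intro x
      simp only [BoundedFormula.realize_imp, BoundedFormula.realize_bdEqual,
        realize_groupNsmul_int, realize_groupZero]
      intro h
      exact (mul_eq_zero.1 h).resolve_left (by exact_mod_cast hk))
  rw [Sentence.Realize, BoundedFormula.realize_alls] at h
  have := h ![a]
  simp only [BoundedFormula.realize_imp, BoundedFormula.realize_bdEqual,
    realize_groupNsmul hM, realize_groupZero] at this
  exact this

/-- Division with remainder by a positive integer. -/
theorem exists_quotient_of_model (hM : M ⊨ groupLang.completeTheory ℤ) (N : ℕ) (hN : 0 < N)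
    (a : M) :
    letI := groupOfModel M hM
    letI := oneOfModel M
    ∃ (j : Fin N) (q : M), a = N • q + (j : ℕ) • (1 : M) := by
  let := groupOfModel M hM
  let := oneOfModel M
  change ∃ (j : Fin N) (q : M), a = N • q + (j : ℕ) • (1 : M)
  have h := realize_of_int hM
    (BoundedFormula.iSup (fun j : Fin N => ((&0) =' groupAdd (groupNsmul N (&1))
      (groupNsmul j (Constants.term (L := groupLang) GroupFunc.one)))) :
      groupLang.BoundedFormula Empty 2).ex.alls (by
      rw [Sentence.Realize, BoundedFormula.realize_alls]
      intro x
      simp only [BoundedFormula.realize_ex, BoundedFormula.realize_iSup,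
        BoundedFormula.realize_bdEqual, realize_groupNsmul_int, realize_groupAdd]
      have hN' : (0 : ℤ) < N := by exact_mod_cast hN
      have h0 := Int.emod_nonneg (x 0) hN'.ne'
      have h1 := Int.emod_lt_of_pos (x 0) hN'
      refine ⟨x 0 / N, ⟨(x 0 % N).toNat, by omega⟩, ?_⟩
      change x 0 = N * (x 0 / N) + (((x 0 % N).toNat : ℕ) : ℤ) * 1
      rw [Int.toNat_of_nonneg h0, mul_one, Int.mul_ediv_add_emod])
  rw [Sentence.Realize, BoundedFormula.realize_alls] at h
  have := h ![a]
  simp only [BoundedFormula.realize_ex, BoundedFormula.realize_iSup,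
    BoundedFormula.realize_bdEqual, realize_groupNsmul hM, realize_groupAdd] at this
  obtain ⟨q, j, h⟩ := this
  refine ⟨j, q, h.trans ?_⟩
  have e : (Constants.term (L := groupLang) GroupFunc.one :
      groupLang.Term (Empty ⊕ Fin 2)).realize (Sum.elim default (Fin.snoc ![a] q)) = (1 : M) := by
    rw [Constants.term, Term.realize_func]
    exact congrArg _ (Subsingleton.elim _ _)
  rw [e]
  rfl

end GroupModel

/-! ### Models of the definitional expansion -/

section Model

/-- The models of `T_±`. -/
abbrev PMModel (ψ : PatternFamily) := (theoryPM ψ).ModelType.{0, 0, 0}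

variable {ψ : PatternFamily}

instance (M : PMModel ψ) : langP.Structure M :=
  (LHom.sumInl : langP →ᴸ langPM).reduct M

instance (M : PMModel ψ) : groupLang.Structure M :=
  (LHom.sumInl : groupLang →ᴸ langP).reduct M

theorem model_theoryP (M : PMModel ψ) : M ⊨ theoryP ψ := by
  rw [← LHom.onTheory_model (LHom.sumInl : langP →ᴸ langPM)]
  exact M.is_model.mono Set.subset_union_left

theorem model_completeTheory (M : PMModel ψ) :
    M ⊨ groupLang.completeTheory ℤ := by
  rw [← LHom.onTheory_model (LHom.sumInl : groupLang →ᴸ langP)]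
  exact (model_theoryP M).mono Set.subset_union_left

instance (M : PMModel ψ) : AddCommGroup M :=
  groupOfModel M (model_completeTheory M)

instance (M : PMModel ψ) : One M := oneOfModel M

instance (M : PMModel ψ) : IsGroupStructure M where
  funMap_zero v := congrArg (Structure.funMap (L := groupLang) (M := M) GroupFunc.zero)
    (Subsingleton.elim v ![])
  funMap_one v := congrArg (Structure.funMap (L := groupLang) (M := M) GroupFunc.one)
    (Subsingleton.elim v ![])
  funMap_neg v := congrArg (Structure.funMap (L := groupLang) (M := M) GroupFunc.neg)
    (a₂ := ![v 0]) (by funext i; fin_cases i; rfl)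
  funMap_add v := congrArg (Structure.funMap (L := groupLang) (M := M) GroupFunc.add)
    (a₂ := ![v 0, v 1]) (by funext i; fin_cases i <;> rfl)

variable (M : PMModel ψ)

theorem model_torsionFree {k : ℕ} (hk : k ≠ 0) {a b : M} (h : k • a = k • b) : a = b := by
  rw [← sub_eq_zero]
  refine torsionFree_of_model (model_completeTheory M) k hk _ ?_
  change k • (a - b) = 0
  rw [smul_sub, h, sub_self]

theorem model_exists_quotient {N : ℕ} (hN : 0 < N) (a : M) :
    ∃ (j : Fin N) (q : M), a = N • q + (j : ℕ) • (1 : M) :=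
  exists_quotient_of_model (model_completeTheory M) N hN a

theorem model_pattern {n : ℕ} (k : Fin n → ℤ) (I : Finset (Fin n)) (x : Fin n → M) :
    (∃ y : M, ∀ i, InP (x i + k i • y) ↔ i ∈ I) ↔ (ψ n k I).Realize default x :=
  realize_patternSentence k I _ |>.1
    ((Theory.model_iff _).1 (model_theoryP M) _ (Or.inr ⟨n, k, I, rfl⟩)) x

theorem realize_sumInl_onTerm {α : Type} (t : langP.Term α) (v : α → M) :
    ((LHom.sumInl : langP →ᴸ langPM).onTerm t).realize v = t.realize v :=
  LHom.realize_onTerm _ t v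

theorem model_symPos (m : ℕ+) (a : M) :
    Structure.RelMap (symPos m) ![a] ↔ ∃ y : M, a = (m : ℕ) • y ∧ InP y := by
  have h := (Theory.model_iff _).1 M.is_model (divPosAxiom m) (Or.inr (Or.inl ⟨m, rfl⟩))
  rw [divPosAxiom, Sentence.Realize, BoundedFormula.realize_alls] at h
  have h := h ![a]
  rw [BoundedFormula.realize_iff, LHom.realize_onBoundedFormula, realize_divPos,
    BoundedFormula.realize_rel₁] at h
  exact h

theorem model_symNeg (m : ℕ+) (a : M) :
    Structure.RelMap (symNeg m) ![a] ↔ ∃ y : M, a = (m : ℕ) • y ∧ ¬ InP y := by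
  have h := (Theory.model_iff _).1 M.is_model (divNegAxiom m) (Or.inr (Or.inr ⟨m, rfl⟩))
  rw [divNegAxiom, Sentence.Realize, BoundedFormula.realize_alls] at h
  have h := h ![a]
  rw [BoundedFormula.realize_iff, LHom.realize_onBoundedFormula, realize_divNeg,
    BoundedFormula.realize_rel₁] at h
  exact h

/-- In a model, `0` is the only element around which `P` has a gap of length `2 R`. Every element
satisfies one of the two patterns `x ∈ P` and `x ∉ P`, in which `y` does not occur. -/
theorem model_eq_zero_iff {R : ℤ} (hψ : ImpliesGap ψ R) (a : M) :
    a = 0 ↔ ∀ m ∈ Finset.Ico (-R) R, ¬ InP (a + m • (1 : M)) := by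
  classical
  have h := (model_pattern M (n := 1) (fun _ => 0)
    (Finset.univ.filter fun _ => InP a) (fun _ => a)).1 ⟨0, fun i => by
      rw [zero_smul, add_zero, Finset.mem_filter]
      exact (and_iff_right (Finset.mem_univ i)).symm⟩
  exact (realize_gapFormula R (0 : Fin 1) _ _).1 (hψ _ _ _ M _ h 0)

end Model

/-! ### Uniformly quantifier-free predicates -/

section QFPred

/-- A predicate of tuples from the models of `T_±` that is defined in all models by one and the
same quantifier-free formula. -/
def IsQFPred (ψ : PatternFamily) {α : Type} {k : ℕ}
    (S : ∀ M : PMModel ψ, (α → M) → (Fin k → M) → Prop) : Prop :=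
  ∃ θ : langPM.BoundedFormula α k, θ.IsQF ∧ ∀ M v x, θ.Realize v x ↔ S M v x

variable {ψ : PatternFamily} {α : Type} {k : ℕ}

namespace IsQFPred

variable {S S' : ∀ M : PMModel ψ, (α → M) → (Fin k → M) → Prop}

theorem congr (hS : IsQFPred ψ S) (h : ∀ M v x, S M v x ↔ S' M v x) : IsQFPred ψ S' := by
  obtain ⟨θ, h1, h2⟩ := hS
  exact ⟨θ, h1, fun M v x => (h2 M v x).trans (h M v x)⟩

theorem false : IsQFPred ψ fun M (_ : α → M) (_ : Fin k → M) => False :=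
  ⟨_, .falsum, fun _ _ _ => Iff.rfl⟩

theorem imp (hS : IsQFPred ψ S) (hS' : IsQFPred ψ S') :
    IsQFPred ψ fun M v x => S M v x → S' M v x := by
  obtain ⟨θ, h1, h2⟩ := hS
  obtain ⟨θ', h1', h2'⟩ := hS'
  exact ⟨θ.imp θ', h1.imp h1', fun M v x => by rw [BoundedFormula.realize_imp, h2, h2']⟩

theorem not (hS : IsQFPred ψ S) : IsQFPred ψ fun M v x => ¬ S M v x :=
  hS.imp false

theorem const (p : Prop) : IsQFPred ψ fun M (_ : α → M) (_ : Fin k → M) => p := by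
  by_cases hp : p
  · exact false.not.congr fun _ _ _ => by simp [hp]
  · exact false.congr fun _ _ _ => by simp [hp]

theorem and (hS : IsQFPred ψ S) (hS' : IsQFPred ψ S') :
    IsQFPred ψ fun M v x => S M v x ∧ S' M v x :=
  (hS.imp hS'.not).not.congr fun _ _ _ => by tauto

theorem or (hS : IsQFPred ψ S) (hS' : IsQFPred ψ S') :
    IsQFPred ψ fun M v x => S M v x ∨ S' M v x :=
  (hS.not.imp hS').congr fun _ _ _ => by tauto

theorem iff (hS : IsQFPred ψ S) (hS' : IsQFPred ψ S') :
    IsQFPred ψ fun M v x => (S M v x ↔ S' M v x) :=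
  ((hS.imp hS').and (hS'.imp hS)).congr fun _ _ _ => by tauto

theorem exists_fintype {β : Type*} [Fintype β]
    {S : β → ∀ M : PMModel ψ, (α → M) → (Fin k → M) → Prop}
    (h : ∀ b, IsQFPred ψ (S b)) : IsQFPred ψ fun M v x => ∃ b, S b M v x := by
  classical
  have key : ∀ s : Finset β, IsQFPred ψ fun M v x => ∃ b ∈ s, S b M v x := by
    intro s
    induction s using Finset.induction_on with
    | empty => exact false.congr fun _ _ _ => by simp
    | insert b s _ ih => exact ((h b).or ih).congr fun _ _ _ => by simp
  exact (key Finset.univ).congr fun _ _ _ => by simp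

theorem forall_fintype {β : Type*} [Fintype β]
    {S : β → ∀ M : PMModel ψ, (α → M) → (Fin k → M) → Prop}
    (h : ∀ b, IsQFPred ψ (S b)) : IsQFPred ψ fun M v x => ∀ b, S b M v x :=
  (exists_fintype fun b => (h b).not).not.congr fun _ _ _ => by simp

theorem eq (s t : langP.Term (α ⊕ Fin k)) : IsQFPred ψ fun M v x =>
    (s.realize (Sum.elim v x) : M) = t.realize (Sum.elim v x) :=
  ⟨(LHom.sumInl : langP →ᴸ langPM).onTerm s =' (LHom.sumInl : langP →ᴸ langPM).onTerm t,
    .of_isAtomic (.equal _ _), fun M v x => by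
      rw [BoundedFormula.realize_bdEqual, realize_sumInl_onTerm, realize_sumInl_onTerm]⟩

theorem divPos (m : ℕ+) (t : langP.Term (α ⊕ Fin k)) : IsQFPred ψ fun M v x =>
    ∃ y : M, t.realize (Sum.elim v x) = (m : ℕ) • y ∧ InP y :=
  ⟨(symPos m).boundedFormula₁ ((LHom.sumInl : langP →ᴸ langPM).onTerm t),
    .of_isAtomic (.rel _ _), fun M v x => by
      rw [BoundedFormula.realize_rel₁, realize_sumInl_onTerm, model_symPos]⟩

theorem divNeg (m : ℕ+) (t : langP.Term (α ⊕ Fin k)) : IsQFPred ψ fun M v x =>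
    ∃ y : M, t.realize (Sum.elim v x) = (m : ℕ) • y ∧ ¬ InP y :=
  ⟨(symNeg m).boundedFormula₁ ((LHom.sumInl : langP →ᴸ langPM).onTerm t),
    .of_isAtomic (.rel _ _), fun M v x => by
      rw [BoundedFormula.realize_rel₁, realize_sumInl_onTerm, model_symNeg]⟩

theorem dvd (m : ℕ+) (t : langP.Term (α ⊕ Fin k)) : IsQFPred ψ fun M v x =>
    ∃ y : M, t.realize (Sum.elim v x) = (m : ℕ) • y := by
  refine ((divPos m t).or (divNeg m t)).congr fun M v x => ?_
  rw [← exists_or]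
  refine exists_congr fun y => ?_
  tauto

end IsQFPred

/-! ### Terms in rescaled variables -/

/-- If `N z_i` is given by a term in `x` for all `i`, then so is `N t(z)`. -/
theorem exists_term_nsmul {n : ℕ} (N : ℕ) (τ : Fin n → langP.Term (α ⊕ Fin k))
    (t : langP.Term (Empty ⊕ Fin n)) : ∃ t' : langP.Term (α ⊕ Fin k),
      ∀ (M : PMModel ψ) (v : α → M) (x : Fin k → M) (z : Fin n → M),
        (∀ i, N • z i = (τ i).realize (Sum.elim v x)) →
          N • t.realize (Sum.elim default z) = t'.realize (Sum.elim v x) := by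
  induction t with
  | var i =>
    rcases i with i | i
    · exact i.elim
    · exact ⟨τ i, fun M v x z h => h i⟩
  | func f ts ih =>
    rcases f with f | f
    · choose t' ht' using ih
      cases f with
      | zero =>
        refine ⟨zeroTerm, fun M v x z h => ?_⟩
        rw [realize_zeroTerm]
        exact (congrArg (N • ·) (IsGroupStructure.funMap_zero (M := M) _)).trans (smul_zero _)
      | one =>
        refine ⟨nsmulTerm N oneTerm, fun M v x z h => ?_⟩
        rw [realize_nsmulTerm, realize_oneTerm]
        exact congrArg (N • ·) (IsGroupStructure.funMap_one (M := M) _)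
      | neg =>
        refine ⟨negTerm (t' 0), fun M v x z h => ?_⟩
        rw [realize_negTerm, ← ht' 0 M v x z h]
        exact (congrArg (N • ·) (IsGroupStructure.funMap_neg (M := M) _)).trans (smul_neg _ _)
      | add =>
        refine ⟨addTerm (t' 0) (t' 1), fun M v x z h => ?_⟩
        rw [realize_addTerm, ← ht' 0 M v x z h, ← ht' 1 M v x z h]
        exact (congrArg (N • ·) (IsGroupStructure.funMap_add (M := M) _)).trans (smul_add _ _ _)
    · exact Empty.elim f

/-- If `N z_i` is given by a term in `x` for all `i`, then a quantifier-free condition on `z` is a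
quantifier-free condition on `x`: multiply all terms by `N`. -/
theorem exists_isQF_nsmul {n : ℕ} (N : ℕ+) (τ : Fin n → langP.Term (α ⊕ Fin k))
    {φ : langP.BoundedFormula Empty n} (hφ : IsQFWithDiv φ) :
    ∃ θ : langPM.BoundedFormula α k, θ.IsQF ∧
      ∀ (M : PMModel ψ) (v : α → M) (x : Fin k → M) (z : Fin n → M),
        (∀ i, (N : ℕ) • z i = (τ i).realize (Sum.elim v x)) →
          (φ.Realize default z ↔ θ.Realize v x) := by
  have hN : (N : ℕ) ≠ 0 := N.ne_zero
  induction hφ with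
  | falsum => exact ⟨⊥, BoundedFormula.isQF_bot, fun _ _ _ _ _ => Iff.rfl⟩
  | @of_isAtomic φ h =>
    cases h with
    | equal t₁ t₂ =>
      obtain ⟨t₁', h₁⟩ := exists_term_nsmul (ψ := ψ) N τ t₁
      obtain ⟨t₂', h₂⟩ := exists_term_nsmul (ψ := ψ) N τ t₂
      obtain ⟨θ, hθ, h⟩ := IsQFPred.eq (ψ := ψ) t₁' t₂'
      refine ⟨θ, hθ, fun M v x z hz => ?_⟩
      rw [h, BoundedFormula.realize_bdEqual]
      dsimp only
      rw [← h₁ M v x z hz, ← h₂ M v x z hz]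
      exact ⟨congrArg _, model_torsionFree M hN⟩
    | @rel l R ts =>
      rcases R with R | R
      · exact Empty.elim R
      · cases R
        obtain ⟨t', h'⟩ := exists_term_nsmul (ψ := ψ) N τ (ts 0)
        obtain ⟨θ, hθ, h⟩ := IsQFPred.divPos (ψ := ψ) N t'
        refine ⟨θ, hθ, fun M v x z hz => ?_⟩
        refine (realize_boundedFormula_one (symP) ts default z).trans (Iff.trans ?_ (h M v x).symm)
        dsimp only
        rw [← h' M v x z hz]
        constructor
        · exact fun h => ⟨_, rfl, h⟩
        · rintro ⟨y, hy, hP⟩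
          rwa [model_torsionFree M hN hy]
  | divPos m t =>
    obtain ⟨t', h'⟩ := exists_term_nsmul (ψ := ψ) N τ t
    obtain ⟨θ, hθ, h⟩ := IsQFPred.divPos (ψ := ψ) (N * m) t'
    refine ⟨θ, hθ, fun M v x z hz => ?_⟩
    rw [h, realize_divPos]
    dsimp only
    rw [← h' M v x z hz]
    refine exists_congr fun y => and_congr_left fun _ => ?_
    rw [PNat.mul_coe, mul_smul]
    exact ⟨congrArg _, model_torsionFree M hN⟩
  | divNeg m t =>
    obtain ⟨t', h'⟩ := exists_term_nsmul (ψ := ψ) N τ t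
    obtain ⟨θ, hθ, h⟩ := IsQFPred.divNeg (ψ := ψ) (N * m) t'
    refine ⟨θ, hθ, fun M v x z hz => ?_⟩
    rw [h, realize_divNeg]
    dsimp only
    rw [← h' M v x z hz]
    refine exists_congr fun y => and_congr_left fun _ => ?_
    rw [PNat.mul_coe, mul_smul]
    exact ⟨congrArg _, model_torsionFree M hN⟩
  | imp _ _ ih₁ ih₂ =>
    obtain ⟨θ₁, hθ₁, h₁⟩ := ih₁
    obtain ⟨θ₂, hθ₂, h₂⟩ := ih₂
    refine ⟨θ₁.imp θ₂, hθ₁.imp hθ₂, fun M v x z hz => ?_⟩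
    rw [BoundedFormula.realize_imp, BoundedFormula.realize_imp, h₁ M v x z hz, h₂ M v x z hz]

/-! ### Separating one variable in a quantifier-free formula -/

/-- A term is the sum of a term in which the last variable `y` does not occur and of an integral
multiple of `y`. -/
theorem exists_term_add_zsmul (t : langPM.Term (α ⊕ Fin (k + 1))) :
    ∃ (τ : langP.Term (α ⊕ Fin k)) (c : ℤ), ∀ (M : PMModel ψ) (v : α → M)
      (x : Fin k → M) (y : M), t.realize (Sum.elim v (Fin.snoc x y : Fin (k + 1) → M)) =
        τ.realize (Sum.elim v x) + c • y := by
  induction t with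
  | var i =>
    rcases i with i | i
    · exact ⟨Term.var (Sum.inl i), 0, fun M v x y => by simp⟩
    · refine Fin.lastCases ?_ (fun i => ?_) i
      · refine ⟨zeroTerm, 1, fun M v x y => ?_⟩
        rw [realize_zeroTerm, zero_add, one_smul]
        simp
      · exact ⟨Term.var (Sum.inr i), 0, fun M v x y => by simp⟩
  | func f ts ih =>
    rcases f with f | f
    swap
    · exact Empty.elim f
    rcases f with f | f
    swap
    · exact Empty.elim f
    choose τ c h using ih
    cases f with
    | zero =>
      refine ⟨zeroTerm, 0, fun M v x y => ?_⟩
      rw [realize_zeroTerm, zero_smul, add_zero]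
      exact IsGroupStructure.funMap_zero (M := M) _
    | one =>
      refine ⟨oneTerm, 0, fun M v x y => ?_⟩
      rw [realize_oneTerm, zero_smul, add_zero]
      exact IsGroupStructure.funMap_one (M := M) _
    | neg =>
      refine ⟨negTerm (τ 0), -c 0, fun M v x y => ?_⟩
      refine (IsGroupStructure.funMap_neg (M := M) _).trans ?_
      rw [h 0 M v x y, realize_negTerm, neg_add, neg_smul]
    | add =>
      refine ⟨addTerm (τ 0) (τ 1), c 0 + c 1, fun M v x y => ?_⟩
      refine (IsGroupStructure.funMap_add (M := M) _).trans ?_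
      rw [h 0 M v x y, h 1 M v x y, realize_addTerm, add_smul]
      abel

/-- `a` is `m` times an element that lies in `P` or not, according to `σ`. For true and false `σ`
these are the predicates `D_{m,+}` and `D_{m,-}`. -/
def DivSign {M : Type} [langP.Structure M] [AddCommGroup M] (σ : Prop) (m : ℕ) (a : M) : Prop :=
  ∃ z : M, a = m • z ∧ (InP z ↔ σ)

/-- A quantifier-free formula in `x` and `y` is a Boolean combination of conditions
`D_{m,±}(τ(x) + c y)`; equations are replaced by means of the gap of `P` at `0`. -/
theorem exists_divSign {R : ℤ} (hψ : ImpliesGap ψ R) {θ : langPM.BoundedFormula α (k + 1)}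
    (hθ : θ.IsQF) : ∃ (ι : Type) (_ : Fintype ι) (m : ι → ℕ+) (σ : ι → Prop)
      (τ : ι → langP.Term (α ⊕ Fin k)) (c : ι → ℤ) (G : (ι → Prop) → Prop),
      ∀ (M : PMModel ψ) (v : α → M) (x : Fin k → M) (y : M),
        θ.Realize v (Fin.snoc x y) ↔
          G fun i => DivSign (σ i) (m i) ((τ i).realize (Sum.elim v x) + c i • y) := by
  have single : ∀ (φ : langPM.BoundedFormula α (k + 1)) (m : ℕ+) (σ : Prop)
      (t : langPM.Term (α ⊕ Fin (k + 1))), (∀ (M : PMModel ψ) (v : α → M)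
        (x : Fin (k + 1) → M), φ.Realize v x ↔ DivSign σ m (t.realize (Sum.elim v x))) →
      ∃ (ι : Type) (_ : Fintype ι) (m : ι → ℕ+) (σ : ι → Prop)
      (τ : ι → langP.Term (α ⊕ Fin k)) (c : ι → ℤ) (G : (ι → Prop) → Prop),
      ∀ (M : PMModel ψ) (v : α → M) (x : Fin k → M) (y : M),
        φ.Realize v (Fin.snoc x y) ↔
          G fun i => DivSign (σ i) (m i) ((τ i).realize (Sum.elim v x) + c i • y) := by
    intro φ m σ t h
    obtain ⟨τ, c, ht⟩ := exists_term_add_zsmul (ψ := ψ) t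
    refine ⟨Unit, inferInstance, fun _ => m, fun _ => σ, fun _ => τ, fun _ => c, fun s => s (),
      fun M v x y => ?_⟩
    rw [h, ht]
  induction hθ with
  | falsum =>
    exact ⟨Empty, inferInstance, Empty.elim, Empty.elim, Empty.elim, Empty.elim, fun _ => False,
      fun _ _ _ _ => Iff.rfl⟩
  | @of_isAtomic φ h =>
    cases h with
    | equal t₁ t₂ =>
      obtain ⟨τ₁, c₁, h₁⟩ := exists_term_add_zsmul (ψ := ψ) t₁
      obtain ⟨τ₂, c₂, h₂⟩ := exists_term_add_zsmul (ψ := ψ) t₂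
      refine ⟨Finset.Ico (-R) R, inferInstance, fun _ => 1, fun _ => True,
        fun m => addTerm (addTerm τ₁ (negTerm τ₂)) (zsmulTerm m oneTerm), fun _ => c₁ - c₂,
        fun s => ∀ i, ¬ s i, fun M v x y => ?_⟩
      rw [BoundedFormula.realize_bdEqual, h₁, h₂, ← sub_eq_zero, model_eq_zero_iff M hψ]
      refine Iff.trans ?_ Subtype.forall.symm
      refine forall₂_congr fun m _ => not_congr ?_
      simp only [DivSign, PNat.one_coe, one_smul, iff_true, exists_eq_left', realize_addTerm,
        realize_negTerm, realize_zsmulTerm, realize_oneTerm]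
      refine iff_of_eq (congrArg _ ?_)
      rw [sub_smul]
      abel
    | @rel l R ts =>
      rcases R with R | R
      · rcases R with R | R
        · exact Empty.elim R
        · cases R
          refine single _ 1 True (ts 0) fun M v x => ?_
          simp only [DivSign, PNat.one_coe, one_smul, iff_true, exists_eq_left']
          exact realize_boundedFormula_one (L := langPM) (Sum.inl symP) ts v x
      · cases R with
        | pos m =>
          refine single _ m True (ts 0) fun M v x => ?_
          simp only [DivSign, iff_true]
          rw [← model_symPos]
          exact realize_boundedFormula_one (symPos m) ts v x
        | neg m =>
          refine single _ m False (ts 0) fun M v x => ?_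
          simp only [DivSign, iff_false]
          rw [← model_symNeg]
          exact realize_boundedFormula_one (symNeg m) ts v x
  | imp _ _ ih₁ ih₂ =>
    obtain ⟨ι₁, _, m₁, σ₁, τ₁, c₁, G₁, h₁⟩ := ih₁
    obtain ⟨ι₂, _, m₂, σ₂, τ₂, c₂, G₂, h₂⟩ := ih₂
    refine ⟨ι₁ ⊕ ι₂, inferInstance, Sum.elim m₁ m₂, Sum.elim σ₁ σ₂, Sum.elim τ₁ τ₂,
      Sum.elim c₁ c₂, fun s => G₁ (fun i => s (Sum.inl i)) → G₂ (fun i => s (Sum.inr i)),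
      fun M v x y => ?_⟩
    rw [BoundedFormula.realize_imp, h₁, h₂]
    rfl

theorem divSign_mul (M : PMModel ψ) (σ : Prop) (m : ℕ) {l : ℕ} (hl : l ≠ 0)
    (a : M) : DivSign σ (l * m) (l • a) ↔ DivSign σ m a := by
  refine exists_congr fun z => and_congr_left fun _ => ?_
  rw [mul_smul]
  exact ⟨model_torsionFree M hl, congrArg _⟩

/-- The conditions `D_{m,±}(τ(x) + c y)` in a quantifier-free formula can be given one and the
same modulus `m = N`. -/
theorem exists_divSign_common {R : ℤ} (hψ : ImpliesGap ψ R)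
    {θ : langPM.BoundedFormula α (k + 1)} (hθ : θ.IsQF) : ∃ (n : ℕ) (N : ℕ+) (σ : Fin n → Prop)
      (τ : Fin n → langP.Term (α ⊕ Fin k)) (c : Fin n → ℤ) (G : (Fin n → Prop) → Prop),
      ∀ (M : PMModel ψ) (v : α → M) (x : Fin k → M) (y : M),
        θ.Realize v (Fin.snoc x y) ↔
          G fun i => DivSign (σ i) N ((τ i).realize (Sum.elim v x) + c i • y) := by
  obtain ⟨ι, _, m, σ, τ, c, G, h⟩ := exists_divSign hψ hθ
  have hdvd : ∀ i, ∃ l : ℕ+, ∏ i, m i = l * m i := fun i => by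
    obtain ⟨l, hl⟩ := Finset.dvd_prod_of_mem m (Finset.mem_univ i)
    exact ⟨l, hl.trans (mul_comm _ _)⟩
  choose l hl using hdvd
  let e := Fintype.equivFin ι
  refine ⟨Fintype.card ι, ∏ i, m i, fun i => σ (e.symm i),
    fun i => nsmulTerm (l (e.symm i)) (τ (e.symm i)), fun i => l (e.symm i) * c (e.symm i),
    fun s => G fun i => s (e i), fun M v x y => ?_⟩
  rw [h]
  refine iff_of_eq (congrArg G ?_)
  funext i
  simp only [Equiv.symm_apply_apply, realize_nsmulTerm]
  rw [hl i, PNat.mul_coe, mul_smul, natCast_zsmul, ← smul_add, divSign_mul M _ _ (l i).ne_zero]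

/-! ### Elimination of one quantifier -/

section Element

variable (M : PMModel ψ) {n : ℕ} {N : ℕ}

/-- The condition `D_{N,±}(a + c y)` at `y = N q + j` is a condition on the divisibility of
`a + c j` by `N` together with a condition on `z + c q ∈ P`, where `N z = a + c j`. -/
theorem divSign_quotient (hN : 0 < N) (σ p : Prop) (a z q : M) (c : ℤ) (j : ℕ)
    (hp : p ↔ ∃ w : M, a + (c * j) • (1 : M) = N • w)
    (hz : p → N • z = a + (c * j) • (1 : M)) :
    DivSign σ N (a + c • (N • q + j • (1 : M))) ↔ p ∧ (InP (z + c • q) ↔ σ) := by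
  have e : a + c • (N • q + j • (1 : M)) = a + (c * j) • (1 : M) + N • (c • q) := by
    rw [smul_add, smul_comm c N q, mul_smul, natCast_zsmul]
    abel
  rw [e]
  constructor
  · rintro ⟨w, hw, h⟩
    have hp' : p := hp.2 ⟨w - c • q, by rw [smul_sub, ← hw]; abel⟩
    refine ⟨hp', ?_⟩
    rw [← hz hp', ← smul_add] at hw
    rwa [model_torsionFree M hN.ne' hw]
  · rintro ⟨hp', h⟩
    exact ⟨z + c • q, by rw [← hz hp', smul_add], h⟩

/-- Splitting `y = N q + j` turns an existential statement about the conditions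
`D_{N,±}(a_i + c_i y)` into existential pattern statements. -/
theorem exists_divSign_iff_exists_pattern (hN : 0 < N) (σ : Fin n → Prop) (a : Fin n → M)
    (c : Fin n → ℤ) (G : (Fin n → Prop) → Prop) :
    (∃ y : M, G fun i => DivSign (σ i) N (a i + c i • y)) ↔
      ∃ (j : Fin N) (J I : Finset (Fin n)), G (fun i => i ∈ J ∧ (i ∈ I ↔ σ i)) ∧
        (∀ i, i ∈ J ↔ ∃ w : M, a i + (c i * (j : ℕ)) • (1 : M) = N • w) ∧
        ∃ z : Fin n → M, (∀ i, N • z i = if i ∈ J then a i + (c i * (j : ℕ)) • (1 : M) else 0) ∧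
          ∃ q : M, ∀ i, InP (z i + c i • q) ↔ i ∈ I := by
  classical
  constructor
  · rintro ⟨y, hy⟩
    obtain ⟨j, q, rfl⟩ := model_exists_quotient M hN y
    let J : Finset (Fin n) :=
      Finset.univ.filter fun i => ∃ w : M, a i + (c i * (j : ℕ)) • (1 : M) = N • w
    have hJ : ∀ i, i ∈ J ↔ ∃ w : M, a i + (c i * (j : ℕ)) • (1 : M) = N • w := fun i => by
      simp [J]
    have hz : ∀ i, ∃ z : M, N • z = if i ∈ J then a i + (c i * (j : ℕ)) • (1 : M) else 0 := by
      intro i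
      split_ifs with h
      · obtain ⟨w, hw⟩ := (hJ i).1 h
        exact ⟨w, hw.symm⟩
      · exact ⟨0, smul_zero _⟩
    choose z hz using hz
    let I : Finset (Fin n) := Finset.univ.filter fun i => InP (z i + c i • q)
    have hI : ∀ i, InP (z i + c i • q) ↔ i ∈ I := fun i => by simp [I]
    refine ⟨j, J, I, ?_, hJ, z, hz, q, hI⟩
    convert hy using 1
    funext i
    rw [divSign_quotient M hN (σ i) (i ∈ J) (a i) (z i) q (c i) j (hJ i)
      (fun h => by rw [hz i, if_pos h]), hI]
  · rintro ⟨j, J, I, hG, hJ, z, hz, q, hI⟩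
    refine ⟨N • q + (j : ℕ) • (1 : M), ?_⟩
    convert hG using 1
    funext i
    rw [divSign_quotient M hN (σ i) (i ∈ J) (a i) (z i) q (c i) j (hJ i)
      (fun h => by rw [hz i, if_pos h]), hI]

end Element

/-- Elimination of an existential quantifier in front of a quantifier-free formula. -/
theorem isQFPred_exists {R : ℤ} (hψ : ImpliesGap ψ R)
    (hqf : ∀ (n : ℕ) (k : Fin n → ℤ) (I : Finset (Fin n)), IsQFWithDiv (ψ n k I))
    {θ : langPM.BoundedFormula α (k + 1)} (hθ : θ.IsQF) :
    IsQFPred ψ fun M (v : α → M) (x : Fin k → M) => ∃ y : M, θ.Realize v (Fin.snoc x y) := by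
  classical
  obtain ⟨n, N, σ, τ, c, G, h⟩ := exists_divSign_common hψ hθ
  -- the term `τ_i + c_i j`, replaced by `0` if it is not divisible by `N`
  let s (j : ℕ) (i : Fin n) : langP.Term (α ⊕ Fin k) :=
    addTerm (τ i) (zsmulTerm (c i * j) oneTerm)
  let s' (j : ℕ) (J : Finset (Fin n)) (i : Fin n) : langP.Term (α ⊕ Fin k) :=
    if i ∈ J then s j i else zeroTerm
  have hs : ∀ (M : PMModel ψ) (v : α → M) (x : Fin k → M) j i,
      (s j i).realize (Sum.elim v x) =
        (τ i).realize (Sum.elim v x) + (c i * j) • (1 : M) := fun M v x j i => by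
    simp only [s, realize_addTerm, realize_zsmulTerm, realize_oneTerm]
  have hs' : ∀ (M : PMModel ψ) (v : α → M) (x : Fin k → M) j J i,
      (s' j J i).realize (Sum.elim v x) = if i ∈ J then
        (τ i).realize (Sum.elim v x) + (c i * j) • (1 : M) else 0 := fun M v x j J i => by
    simp only [s']
    split_ifs
    · exact hs M v x j i
    · exact realize_zeroTerm _
  have hθ' := fun (j : ℕ) (J I : Finset (Fin n)) =>
    exists_isQF_nsmul (ψ := ψ) N (s' j J) (hqf n c I)
  choose θ' hqf' hθ' using hθ'
  refine (IsQFPred.exists_fintype fun j : Fin N => IsQFPred.exists_fintype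
    fun J : Finset (Fin n) => IsQFPred.exists_fintype fun I : Finset (Fin n) =>
      (IsQFPred.const (G fun i => i ∈ J ∧ (i ∈ I ↔ σ i))).and
        ((IsQFPred.forall_fintype fun i : Fin n =>
          (IsQFPred.const (i ∈ J)).iff (IsQFPred.dvd N (s j i))).and
            ⟨θ' j J I, hqf' j J I, fun _ _ _ => Iff.rfl⟩)).congr fun M v x => ?_
  simp only [h]
  rw [exists_divSign_iff_exists_pattern M N.pos]
  refine exists_congr fun j => exists_congr fun J => exists_congr fun I =>
    and_congr_right fun _ => ?_
  simp only [hs]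
  refine and_congr_right fun hJ => ?_
  have key : ∀ z : Fin n → M, (∀ i, (N : ℕ) • z i = if i ∈ J then
      (τ i).realize (Sum.elim v x) + (c i * (j : ℕ)) • (1 : M) else 0) →
      ((θ' j J I).Realize v x ↔ ∃ q : M, ∀ i, InP (z i + c i • q) ↔ i ∈ I) := fun z hz => by
    rw [model_pattern]
    exact (hθ' j J I M v x z fun i => (hz i).trans (hs' M v x j J i).symm).symm
  constructor
  · intro h
    have hz : ∀ i, ∃ z : M, (N : ℕ) • z = if i ∈ J then
        (τ i).realize (Sum.elim v x) + (c i * (j : ℕ)) • (1 : M) else 0 := by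
      intro i
      split_ifs with h
      · obtain ⟨w, hw⟩ := (hJ i).1 h
        exact ⟨w, hw.symm⟩
      · exact ⟨0, smul_zero _⟩
    choose z hz using hz
    exact ⟨z, hz, (key z hz).1 h⟩
  · rintro ⟨z, hz, h⟩
    exact (key z hz).2 h

theorem isQFPred_realize {R : ℤ} (hψ : ImpliesGap ψ R)
    (hqf : ∀ (n : ℕ) (k : Fin n → ℤ) (I : Finset (Fin n)), IsQFWithDiv (ψ n k I))
    (φ : langPM.BoundedFormula α k) :
    IsQFPred ψ fun M (v : α → M) (x : Fin k → M) => φ.Realize v x := by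
  induction φ with
  | falsum => exact IsQFPred.false
  | equal t₁ t₂ => exact ⟨_, .of_isAtomic (.equal t₁ t₂), fun _ _ _ => Iff.rfl⟩
  | rel R ts => exact ⟨_, .of_isAtomic (.rel R ts), fun _ _ _ => Iff.rfl⟩
  | imp _ _ ih₁ ih₂ => exact ih₁.imp ih₂
  | all φ ih =>
    obtain ⟨θ, hθ, h⟩ := ih
    refine (isQFPred_exists hψ hqf hθ.not).not.congr fun M v x => ?_
    simp only [BoundedFormula.realize_not, h, not_exists, not_not, BoundedFormula.realize_all]

theorem theoryPM_hasQE {R : ℤ} (hψ : ImpliesGap ψ R)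
    (hqf : ∀ (n : ℕ) (k : Fin n → ℤ) (I : Finset (Fin n)), IsQFWithDiv (ψ n k I)) :
    TheoryHasQE (theoryPM ψ) := by
  intro n φ
  obtain ⟨θ, hθ, h⟩ := isQFPred_realize hψ hqf φ
  refine ⟨θ, hθ, fun M v x => ?_⟩
  rw [BoundedFormula.realize_iff]
  exact (h M v x).symm

end QFPred

/-! ### The integers as a model, and the language without `P` -/

section Integers

variable {r : ℝ} {ψ : PatternFamily}

theorem beattyInt_model
    (hψ : ∀ (n : ℕ) (k : Fin n → ℤ) (I : Finset (Fin n)),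
      BeattyInt r ⊨ patternSentence k I (ψ n k I)) : BeattyInt r ⊨ theoryPM ψ := by
  have hZ : BeattyInt r ⊨ groupLang.completeTheory ℤ :=
    (Theory.model_iff (M := ℤ) (groupLang.completeTheory ℤ)).2 fun _ h => h
  refine Theory.Model.union ((LHom.onTheory_model _ _).2
    (Theory.Model.union ((LHom.onTheory_model _ _).2 hZ) ?_))
    (Theory.Model.union ?_ ?_)
  · refine (Theory.model_iff _).2 ?_
    rintro _ ⟨n, k, I, rfl⟩
    exact hψ n k I
  · refine (Theory.model_iff _).2 ?_
    rintro _ ⟨m, rfl⟩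
    rw [divPosAxiom, Sentence.Realize, BoundedFormula.realize_alls]
    intro x
    rw [BoundedFormula.realize_iff, LHom.realize_onBoundedFormula, realize_divPos,
      BoundedFormula.realize_rel₁]
    refine exists_congr fun y => and_comm.trans (and_congr_left fun _ => ?_)
    exact (Eq.congr_right (toInt_nsmul (r := r) m y)).symm
  · refine (Theory.model_iff _).2 ?_
    rintro _ ⟨m, rfl⟩
    rw [divNegAxiom, Sentence.Realize, BoundedFormula.realize_alls]
    intro x
    rw [BoundedFormula.realize_iff, LHom.realize_onBoundedFormula, realize_divNeg,
      BoundedFormula.realize_rel₁]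
    refine exists_congr fun y => and_comm.trans (and_congr_left fun _ => ?_)
    exact (Eq.congr_right (toInt_nsmul (r := r) m y)).symm

theorem exists_langD_term {α : Type} (t : langPM.Term α) : ∃ t' : langD.Term α,
    ∀ v : α → BeattyInt r, t'.realize v = t.realize v := by
  induction t with
  | var i => exact ⟨Term.var i, fun _ => rfl⟩
  | func f ts ih =>
    choose t' ht' using ih
    rcases f with (f | f) | f
    · exact ⟨Term.func (L := langD) (Sum.inl f) t', fun v =>
        congrArg (Structure.funMap (L := groupLang) (M := BeattyInt r) f)
          (funext fun i => ht' i v)⟩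
    · exact Empty.elim f
    · exact Empty.elim f

/-- In the integers the predicate `P` is redundant, because it is `D_{1,+}`. -/
theorem exists_langD_isQF {α : Type} {k : ℕ} {θ : langPM.BoundedFormula α k} (hθ : θ.IsQF) :
    ∃ θ' : langD.BoundedFormula α k, θ'.IsQF ∧
      ∀ (v : α → BeattyInt r) (x : Fin k → BeattyInt r), θ'.Realize v x ↔ θ.Realize v x := by
  induction hθ with
  | falsum => exact ⟨⊥, BoundedFormula.isQF_bot, fun _ _ => Iff.rfl⟩
  | of_isAtomic h =>
    cases h with
    | equal t₁ t₂ =>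
      obtain ⟨t₁', h₁⟩ := exists_langD_term (r := r) t₁
      obtain ⟨t₂', h₂⟩ := exists_langD_term (r := r) t₂
      refine ⟨t₁' =' t₂', .of_isAtomic (.equal _ _), fun v x => ?_⟩
      rw [BoundedFormula.realize_bdEqual, BoundedFormula.realize_bdEqual, h₁, h₂]
    | rel R ts =>
      have h := fun i => exists_langD_term (r := r) (ts i)
      choose t' ht' using h
      rcases R with (R | R) | R
      · exact Empty.elim R
      · cases R
        refine ⟨Relations.boundedFormula (L := langD) (Sum.inr (DivRel.pos 1)) t',
          .of_isAtomic (.rel _ _), fun v x => ?_⟩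
        refine (realize_boundedFormula_one (L := langD) (Sum.inr (DivRel.pos 1)) t' v x).trans
          (Iff.trans ?_ (realize_boundedFormula_one (L := langPM) (Sum.inl symP) ts v x).symm)
        rw [ht']
        change (∃ y : ℤ, y ∈ beattySet r ∧ BeattyInt.toInt _ = (((1 : ℕ+) : ℕ) : ℤ) * y) ↔
          BeattyInt.toInt _ ∈ beattySet r
        simp
      · refine ⟨Relations.boundedFormula (L := langD) (Sum.inr R) t',
          .of_isAtomic (.rel _ _), fun v x => ?_⟩
        exact iff_of_eq (congrArg (Structure.RelMap (L := divLang) (M := BeattyInt r) R)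
          (funext fun i => ht' i _))
  | imp _ _ ih₁ ih₂ =>
    obtain ⟨θ₁, hθ₁, h₁⟩ := ih₁
    obtain ⟨θ₂, hθ₂, h₂⟩ := ih₂
    exact ⟨θ₁.imp θ₂, hθ₁.imp hθ₂, fun v x => by
      rw [BoundedFormula.realize_imp, BoundedFormula.realize_imp, h₁, h₂]⟩

theorem beattyInt_hasQE (hQE : TheoryHasQE (theoryPM ψ)) (hM : BeattyInt r ⊨ theoryPM ψ) :
    StructureHasQE langD (BeattyInt r) := by
  intro n φ
  let F : langD →ᴸ langPM := (LHom.sumInl : groupLang →ᴸ langP).sumMap (LHom.id divLang)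
  obtain ⟨θ, hθ, h⟩ := hQE n (F.onFormula φ)
  obtain ⟨θ', hθ', h'⟩ := exists_langD_isQF (r := r) hθ
  refine ⟨θ', hθ', fun v => ?_⟩
  have : Nonempty (BeattyInt r) := ⟨0⟩
  have e : (F.onFormula φ).Realize v ↔ φ.Realize v := LHom.realize_onFormula F φ
  rw [← e]
  exact (Theory.Iff.realize_iff h).trans (h' v default).symm

end Integers

end BeattyQE

theorem theorem2 (r : ℝ) (hr : Irrational r) (hr1 : 1 < r) :
    (∃ ψ : BeattyQE.PatternFamily,
      (∀ (n : ℕ) (k : Fin n → ℤ) (I : Finset (Fin n)),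
        BeattyQE.IsQFWithDiv (ψ n k I) ∧
          BeattyQE.BeattyInt r ⊨ BeattyQE.patternSentence k I (ψ n k I)) ∧
      BeattyQE.TheoryHasQE (BeattyQE.theoryPM ψ)) ∧
    BeattyQE.StructureHasQE BeattyQE.langD (BeattyQE.BeattyInt r) := by
  obtain ⟨ψ, h, hgap⟩ := BeattyQE.exists_patternFamily hr hr1
  have hQE := BeattyQE.theoryPM_hasQE hgap fun n k I => (h n k I).1
  exact ⟨⟨ψ, h, hQE⟩,
    BeattyQE.beattyInt_hasQE hQE (BeattyQE.beattyInt_model fun n k I => (h n k I).2)⟩
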